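/- Proposition (The Main Equation of Plain Mechanics). Let $n\ge 0$, $N=2n+1$, and let $\mathbb H^n$ be the Heisenberg group $\mathbb R\times\mathbb R^n\times\mathbb R^n\ni g=(t,x,y)$ with $$(t,x,y)*(t',x',y')=\bigl(t+t'+\tfrac12(y\cdot x'-x\cdot y'),\,x+x',\,y+y'\bigr)$$ and normalised Haar measure $d\nu(g)=(2\pi)^{-N/2}\,dt\,dx\,dy$. For a unitary representation $\pi$ and $k\in L^1(\mathbb H^n)$ put $\pi[k]=\int k(g)\pi(g)\,d\nu(g)$. In particular: * the convolution with kernel $k$ is $K=\pi_l[k]$ on $L^2(\mathbb H^n)$, where $\pi_l(g)F(h)=F(g^{-1}*h)$; * for $\mu=\pm\lambda$, $\lambda>0$, the quantum image is $\pi_\mu[k]$ on $L^2(\mathbb R^n)$, where $\pi_{\pm\lambda}(t,x,y)=e^{i(\pm\lambda t\pm\lambda^{1/2}x\cdot M+\lambda^{1/2}y\cdot D)}$, that is, $(\pi_{\pm\lambda}(t,x,y)u)(v)=e^{i(\pm\lambda t\pm\lambda^{1/2}x\cdot v\pm\lambda x\cdot y/2)}u(v+\lambda^{1/2}y)$; *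 the classical map is $(\pi_0 k)(q,p)=\pi_{(q,p)}[k]$, where $\pi_{(q,p)}(t,x,y)=e^{i(q\cdot x+p\cdot y)}$. So $\pi_0k=\widehat k(0,\cdot,\cdot)$ with $\widehat k(\mu,q,p)=\int e^{i(\mu t+q\cdot x+p\cdot y)}k\,d\nu(g)$. Since commutators are annihilated by all $\pi_{(q,p)}$, the classical image of a kernel $f$ that vanishes to first order in the Planck constant is defined as the function $(q,p)\mapsto\lim_{\mu\to0}\mu^{-1}\widehat f(\mu,q,p)$. Let $j\in L^1(\mathbb H^n)$ be the kernel of the convolution $H$, and let $k(s)\in L^1(\mathbb H^n)$, $s\in\mathbb R$, be the kernels of convolutions $K(s)$. Let $\widetilde H$ be the operator of two-sided convolution with kernel $\widetilde j(g,g_1)=\delta(g)j(g_1)-j(g^{-1})\delta(g_1)$ ($\delta$ the Dirac function with respect to $\nu$): $$(\widetilde Hk)(h)=\iint\widetilde j(g,g_1)\,k(g_1^{-1}*h*g)\,d\nu(g)\,d\nu(g_1) .$$ Consider, at a time $s$, the main equation $$ i\tau\,\frac{\partial K}{\partial t}=-\widetilde HK ,$$ understood for kernels: $t$ is the central coordinate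 of $\mathbb H^n$, $\partial/\partial t$ is taken in the sense of distributions, and $\tau$ is the variable dual to the time $s$ under the Fourier transform $\int e^{i\tau s}(\cdot)\,ds$, i.e. $\tau=i\,\partial/\partial s$, with $\partial k/\partial s$ taken in $L^1(\mathbb H^n)$; both sides are to be integrable functions. Then: 1. $\widetilde Hk(s)$ is integrable, and $[H,K(s)]$ is the convolution with kernel $\widetilde Hk(s)$. 2. (Heisenberg equation) For every real $\mu\neq0$: if $k$ is differentiable at $s$ and $i\tau\,\partial k/\partial t$ is integrable, then $\pi_\mu[k(\cdot)]$ is differentiable at $s$ in operator norm and $\pi_\mu[i\tau\,\partial k/\partial t]=i\mu\,\frac{d}{ds}\pi_\mu[k(s)]$. Moreover $\pi_\mu[-\widetilde Hk(s)]=-[\pi_\mu[j],\pi_\mu[k(s)]]$. Consequently, if the main equation holds at $s$, then $$\frac{d}{ds}\pi_\mu[k(s)]=\frac{i}{\mu}\bigl[\pi_\mu[j],\pi_\mu[k(s)]\bigr].$$ 3. (Hamilton equation) Suppose that $(|x|+|y|)j$ and $(|x|+|y|)k(s)$ are integrable. Then $\pi_0j$ and $\pi_0k(s)$ are differentiable on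 $\mathbb R^{2n}$. If $k$ is differentiable at $s$ and $i\tau\,\partial k/\partial t$ is integrable, then $\pi_0k(\cdot)(q,p)$ is differentiable at $s$ for all $(q,p)$ and the classical image of $i\tau\,\partial k/\partial t$ is $i\,\frac{\partial}{\partial s}\pi_0k(s)$. The classical image of $-\widetilde Hk(s)$ is $i\{\pi_0k(s),\pi_0j\}$, where $\{F,G\}=\sum_i\bigl(\frac{\partial F}{\partial q_i}\frac{\partial G}{\partial p_i}-\frac{\partial F}{\partial p_i}\frac{\partial G}{\partial q_i}\bigr)$. Consequently, if the main equation holds at $s$, then for all $(q,p)$ $$\frac{\partial}{\partial s}\pi_0k(s)(q,p)=\{\pi_0k(s),\pi_0j\}(q,p).$$ -/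

import Mathlib

open MeasureTheory Filter Topology
open scoped ENNReal ContDiff RealInnerProductSpace

noncomputable section

namespace PlainMechanics

/-! ## The Heisenberg group -/

/-- The configuration space `ℝⁿ`. -/
abbrev Config (n : ℕ) : Type := EuclideanSpace ℝ (Fin n)

/-- The Heisenberg group `ℍⁿ`, in the coordinates `(t, x, y) ∈ ℝ × ℝⁿ × ℝⁿ`. As a normed space
and as a measure space it is `ℝ²ⁿ⁺¹`. -/
def Heis (n : ℕ) : Type := ℝ × Config n × Config n

namespace Heis

variable {n : ℕ}

instance : NormedAddCommGroup (Heis n) :=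
  inferInstanceAs (NormedAddCommGroup (ℝ × Config n × Config n))
instance : NormedSpace ℝ (Heis n) := inferInstanceAs (NormedSpace ℝ (ℝ × Config n × Config n))
instance : MeasurableSpace (Heis n) :=
  inferInstanceAs (MeasurableSpace (ℝ × Config n × Config n))
instance : BorelSpace (Heis n) := inferInstanceAs (BorelSpace (ℝ × Config n × Config n))
instance : SecondCountableTopology (Heis n) :=
  inferInstanceAs (SecondCountableTopology (ℝ × Config n × Config n))
instance : LocallyCompactSpace (Heis n) :=
  inferInstanceAs (LocallyCompactSpace (ℝ × Config n × Config n))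
instance : CompleteSpace (Heis n) := inferInstanceAs (CompleteSpace (ℝ × Config n × Config n))

/-- The point with coordinates `(t, x, y)`. -/
def mk (t : ℝ) (x y : Config n) : Heis n := (t, x, y)
/-- The central coordinate `t`. -/
def t (g : Heis n) : ℝ := g.1
/-- The coordinate `x`. -/
def x (g : Heis n) : Config n := g.2.1
/-- The coordinate `y`. -/
def y (g : Heis n) : Config n := g.2.2

@[simp] theorem t_mk (a : ℝ) (b c : Config n) : (mk a b c).t = a := rfl
@[simp] theorem x_mk (a : ℝ) (b c : Config n) : (mk a b c).x = b := rfl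
@[simp] theorem y_mk (a : ℝ) (b c : Config n) : (mk a b c).y = c := rfl

@[ext] theorem ext {g h : Heis n} (ht : g.t = h.t) (hx : g.x = h.x) (hy : g.y = h.y) : g = h :=
  Prod.ext ht (Prod.ext hx hy)

theorem continuous_t : Continuous (t : Heis n → ℝ) :=
  (continuous_fst : Continuous (Prod.fst : ℝ × Config n × Config n → ℝ))
theorem continuous_x : Continuous (x : Heis n → Config n) :=
  (continuous_fst.comp continuous_snd :
    Continuous (fun g : ℝ × Config n × Config n => g.2.1))
theorem continuous_y : Continuous (y : Heis n → Config n) :=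
  (continuous_snd.comp continuous_snd :
    Continuous (fun g : ℝ × Config n × Config n => g.2.2))

/-- The group law
`(t, x, y) * (t', x', y') = (t + t' + (y · x' - x · y') / 2, x + x', y + y')`. -/
instance : Mul (Heis n) :=
  ⟨fun g h => mk (g.t + h.t + (⟪g.y, h.x⟫ - ⟪g.x, h.y⟫) / 2) (g.x + h.x) (g.y + h.y)⟩
instance : One (Heis n) := ⟨mk 0 0 0⟩
instance : Inv (Heis n) := ⟨fun g => mk (-g.t) (-g.x) (-g.y)⟩

@[simp] theorem mul_t (g h : Heis n) :
    (g * h).t = g.t + h.t + (⟪g.y, h.x⟫ - ⟪g.x, h.y⟫) / 2 := rfl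
@[simp] theorem mul_x (g h : Heis n) : (g * h).x = g.x + h.x := rfl
@[simp] theorem mul_y (g h : Heis n) : (g * h).y = g.y + h.y := rfl
@[simp] theorem one_t : (1 : Heis n).t = 0 := rfl
@[simp] theorem one_x : (1 : Heis n).x = 0 := rfl
@[simp] theorem one_y : (1 : Heis n).y = 0 := rfl
@[simp] theorem inv_t (g : Heis n) : (g⁻¹).t = -g.t := rfl
@[simp] theorem inv_x (g : Heis n) : (g⁻¹).x = -g.x := rfl
@[simp] theorem inv_y (g : Heis n) : (g⁻¹).y = -g.y := rfl

instance : Group (Heis n) where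
  mul_assoc a b c := by
    ext1
    · simp only [mul_t, mul_x, mul_y, inner_add_left, inner_add_right]; ring
    · simp [add_assoc]
    · simp [add_assoc]
  one_mul a := by ext1 <;> simp
  mul_one a := by ext1 <;> simp
  inv_mul_cancel a := by
    ext1
    · simp [inner_neg_left, real_inner_comm a.x a.y]
    · simp
    · simp

/-- In the coordinates `u = 4 t`, `v = x + i y` the group law is
`(u, v) * (u', v') = (u + u' - 2 Im ∑ₖ v'ₖ conj vₖ, v + v')`. -/
theorem mul_complex (g h : Heis n) :
    4 * (g * h).t = 4 * g.t + 4 * h.t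
      - 2 * (∑ k, ((h.x k + Complex.I * h.y k : ℂ) *
          (starRingEnd ℂ) (g.x k + Complex.I * g.y k : ℂ))).im := by
  rw [mul_t, Complex.im_sum]
  have h1 : ∀ k, ((h.x k + Complex.I * h.y k : ℂ) *
      (starRingEnd ℂ) (g.x k + Complex.I * g.y k : ℂ)).im
        = h.y k * g.x k - h.x k * g.y k := by
    intro k; simp; ring
  simp only [h1, PiLp.inner_apply, Finset.sum_sub_distrib]
  simp [mul_comm]
  ring

theorem continuous_mul : Continuous (fun p : Heis n × Heis n => p.1 * p.2) := by
  have h1 : Continuous (fun p : Heis n × Heis n => (p.1.t + p.2.t +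
      (⟪p.1.y, p.2.x⟫ - ⟪p.1.x, p.2.y⟫) / 2, p.1.x + p.2.x, p.1.y + p.2.y)) := by
    have := continuous_t (n := n)
    have := continuous_x (n := n)
    have := continuous_y (n := n)
    fun_prop
  exact h1

theorem continuous_inv : Continuous (fun g : Heis n => g⁻¹) :=
  (continuous_id.neg : Continuous (fun g : ℝ × Config n × Config n => -g))

end Heis

/-- The normalised Haar measure `(2π)^{-N/2} dg` of `ℍⁿ`, where `N = 2n + 1` and
`dg = dt dx dy` is the Lebesgue measure. -/
def haar (n : ℕ) : Measure (Heis n) :=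
  ENNReal.ofReal ((2 * Real.pi) ^ (-((2 * n + 1 : ℝ) / 2))) •
    (volume : Measure (ℝ × Config n × Config n))

instance (n : ℕ) : Measure.Regular (haar n) := by
  have : Measure.Regular (ENNReal.ofReal ((2 * Real.pi) ^ (-((2 * n + 1 : ℝ) / 2))) •
    (volume : Measure (ℝ × Config n × Config n))) := Measure.Regular.smul ENNReal.ofReal_ne_top
  exact this

instance (n : ℕ) : SigmaFinite (haar n) := by
  have : IsLocallyFiniteMeasure (haar n) := inferInstance
  infer_instance

theorem measurePreserving_mul_left {n : ℕ} (g : Heis n) :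
    MeasurePreserving (fun h : Heis n => g * h) (haar n) (haar n) := by
  suffices h : MeasurePreserving (fun h : ℝ × Config n × Config n =>
      (g.t + h.1 + (⟪g.y, h.2.1⟫ - ⟪g.x, h.2.2⟫) / 2, g.x + h.2.1, g.y + h.2.2))
      volume volume from h.smul_measure _
  have h1 : MeasurePreserving (fun p : (Config n × Config n) × ℝ =>
      ((g.x + p.1.1, g.y + p.1.2), (g.t + p.2 + (⟪g.y, p.1.1⟫ - ⟪g.x, p.1.2⟫) / 2)))
      (volume.prod volume) (volume.prod volume) := by
    refine MeasurePreserving.skew_product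
      (f := fun q : Config n × Config n => (g.x + q.1, g.y + q.2))
      (g := fun q t => g.t + t + (⟪g.y, q.1⟫ - ⟪g.x, q.2⟫) / 2) ?_ ?_ ?_
    · exact (measurePreserving_add_left volume g.x).prod (measurePreserving_add_left volume g.y)
    · have : Continuous (fun p : (Config n × Config n) × ℝ =>
          g.t + p.2 + (⟪g.y, p.1.1⟫ - ⟪g.x, p.1.2⟫) / 2) := by fun_prop
      exact this.measurable
    · refine Eventually.of_forall fun q => ?_
      have := (measurePreserving_add_left (volume : Measure ℝ)
        (g.t + (⟪g.y, q.1⟫ - ⟪g.x, q.2⟫) / 2)).map_eq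
      rw [← this]
      congr 1
      funext t
      ring_nf
  have h2 := (Measure.measurePreserving_swap (μ := (volume : Measure (Config n × Config n)))
    (ν := (volume : Measure ℝ))).comp
    (h1.comp (Measure.measurePreserving_swap (μ := (volume : Measure ℝ))
      (ν := (volume : Measure (Config n × Config n)))))
  exact h2

/-! ## Unitary representations and their integrated forms -/

/-- A strongly continuous unitary representation of `ℍⁿ` on a normed space `E`. (The operators
are isometric, and invertible because the group is.) -/
structure UnitaryRep (n : ℕ) (E : Type*) [NormedAddCommGroup E] [NormedSpace ℂ E] where
  /-- The homomorphism into the operators. -/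
  hom : Heis n →* (E →L[ℂ] E)
  norm_map : ∀ g u, ‖hom g u‖ = ‖u‖
  strongly_continuous : ∀ u, Continuous fun g => hom g u

section Integrated

variable {n : ℕ} {E : Type*} [NormedAddCommGroup E] [NormedSpace ℂ E]

theorem UnitaryRep.integrable (ρ : UnitaryRep n E) {f : Heis n → ℂ}
    (hf : Integrable f (haar n)) (u : E) :
    Integrable (fun g => f g • ρ.hom g u) (haar n) := by
  refine (hf.norm.mul_const ‖u‖).mono'
    (hf.aestronglyMeasurable.smul (ρ.strongly_continuous u).aestronglyMeasurable) ?_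
  exact Eventually.of_forall fun g => by rw [norm_smul, ρ.norm_map]

open Classical in
/-- The integrated form `ρ[f] = (2π)^{-N/2} ∫ f(g) ρ(g) dg` of a representation, for an integrable
kernel `f` (and the value `0` for other kernels). The integral is taken in the strong sense. -/
def UnitaryRep.integrated (ρ : UnitaryRep n E) (f : Heis n → ℂ) : E →L[ℂ] E :=
  if hf : Integrable f (haar n) then
    LinearMap.mkContinuous
      { toFun := fun u => ∫ g, f g • ρ.hom g u ∂haar n
        map_add' := fun u w => by
          simp only [map_add, smul_add]
          exact integral_add (ρ.integrable hf u) (ρ.integrable hf w)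
        map_smul' := fun c u => by
          simp only [map_smul, RingHom.id_apply]
          rw [← integral_smul]
          exact integral_congr_ae (Eventually.of_forall fun g => smul_comm _ _ _) }
      (∫ g, ‖f g‖ ∂haar n) (fun u => by
        rw [← integral_mul_const]
        refine (norm_integral_le_integral_norm _).trans (le_of_eq ?_)
        exact integral_congr_ae (Eventually.of_forall fun g => by
          simp only [norm_smul, ρ.norm_map]))
  else 0

theorem UnitaryRep.integrated_apply (ρ : UnitaryRep n E) {f : Heis n → ℂ}
    (hf : Integrable f (haar n)) (u : E) :
    ρ.integrated f u = ∫ g, f g • ρ.hom g u ∂haar n := by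
  simp [UnitaryRep.integrated, hf]

end Integrated

/-- `L¹(ℍⁿ)`, the space of kernels of convolutions. -/
abbrev Kernels (n : ℕ) : Type := Lp ℂ 1 (haar n)

/-- The left regular representation `(π_l(g) F)(h) = F(g⁻¹ * h)` on `L²(ℍⁿ)`. -/
def leftRegular (n : ℕ) : UnitaryRep n (Lp ℂ 2 (haar n)) where
  hom :=
    { toFun := fun g => (Lp.compMeasurePreservingₗᵢ ℂ (fun h => g⁻¹ * h)
        (measurePreserving_mul_left g⁻¹)).toContinuousLinearMap
      map_one' := by
        ext1 u
        change Lp.compMeasurePreserving _ _ u = u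
        apply Lp.ext
        filter_upwards [Lp.coeFn_compMeasurePreserving u
          (measurePreserving_mul_left (1 : Heis n)⁻¹)] with h hh
        rw [hh]; simp
      map_mul' := fun g h => by
        ext1 u
        change Lp.compMeasurePreserving _ _ u = Lp.compMeasurePreserving _ _
          (Lp.compMeasurePreserving _ _ u)
        have h1 := Lp.compMeasurePreserving_comp_apply u
          (measurePreserving_mul_left h⁻¹) (measurePreserving_mul_left g⁻¹)
        refine Eq.trans ?_ h1
        have h2 : (fun a => (g * h)⁻¹ * a) = (fun a => h⁻¹ * a) ∘ fun a => g⁻¹ * a := by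
          funext a
          simp [mul_assoc]
        simp only [h2] }
  norm_map g u := LinearIsometry.norm_map _ u
  strongly_continuous u := by
    have hc : Continuous (fun p : Heis n × Heis n => p.1⁻¹ * p.2) :=
      Heis.continuous_mul.comp
        ((Heis.continuous_inv.comp continuous_fst).prodMk continuous_snd)
    exact Continuous.compMeasurePreservingLp (f := fun _ : Heis n => u)
      (g := (ContinuousMap.mk _ hc).curry) continuous_const
      (ContinuousMap.curry _).continuous
      (fun g => measurePreserving_mul_left g⁻¹) (by norm_num)

section Phase

variable {n : ℕ}

theorem memLp_phase {θ : Config n → ℝ} (hθ : Continuous θ) (u : Lp ℂ 2 (volume : Measure (Config n))) :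
    MemLp (fun v => Complex.exp (Complex.I * θ v) * u v) 2 (volume : Measure (Config n)) := by
  refine (Lp.memLp u).congr_norm ?_ (Eventually.of_forall fun v => ?_)
  · exact (by fun_prop : Continuous fun v => Complex.exp (Complex.I * θ v)).aestronglyMeasurable.mul
      (Lp.aestronglyMeasurable u)
  · rw [norm_mul, mul_comm Complex.I, Complex.norm_exp_ofReal_mul_I, one_mul]

/-- The multiplication operator `u ↦ e^{iθ} u` on `L²(ℝⁿ)` for a continuous real function `θ`. -/
def phase (θ : Config n → ℝ) (hθ : Continuous θ) :
    Lp ℂ 2 (volume : Measure (Config n)) →ₗᵢ[ℂ] Lp ℂ 2 (volume : Measure (Config n)) where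
  toFun u := (memLp_phase hθ u).toLp _
  map_add' u w := by
    apply Lp.ext
    filter_upwards [(memLp_phase hθ (u + w)).coeFn_toLp, (memLp_phase hθ u).coeFn_toLp,
      (memLp_phase hθ w).coeFn_toLp, Lp.coeFn_add u w,
      Lp.coeFn_add ((memLp_phase hθ u).toLp _) ((memLp_phase hθ w).toLp _)] with v h1 h2 h3 h4 h5
    rw [h1, h5, Pi.add_apply, h2, h3, h4, Pi.add_apply, mul_add]
  map_smul' c u := by
    apply Lp.ext
    filter_upwards [(memLp_phase hθ (c • u)).coeFn_toLp, (memLp_phase hθ u).coeFn_toLp,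
      Lp.coeFn_smul c u, Lp.coeFn_smul c ((memLp_phase hθ u).toLp _)] with v h1 h2 h3 h4
    rw [h1, RingHom.id_apply, h4, Pi.smul_apply, h2, h3, Pi.smul_apply, smul_eq_mul, smul_eq_mul]
    ring
  norm_map' u := by
    change ‖(memLp_phase hθ u).toLp _‖ = ‖u‖
    rw [Lp.norm_toLp, Lp.norm_def]
    congr 1
    refine eLpNorm_congr_norm_ae (Eventually.of_forall fun v => ?_)
    rw [norm_mul, mul_comm Complex.I, Complex.norm_exp_ofReal_mul_I, one_mul]

theorem coeFn_phase {θ : Config n → ℝ} (hθ : Continuous θ)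
    (u : Lp ℂ 2 (volume : Measure (Config n))) :
    phase θ hθ u =ᵐ[volume] fun v => Complex.exp (Complex.I * θ v) * u v :=
  (memLp_phase hθ u).coeFn_toLp

theorem continuous_phase {X : Type*} [TopologicalSpace X] [FirstCountableTopology X]
    {θ : X → Config n → ℝ} (hθ : Continuous (fun p : X × Config n => θ p.1 p.2))
    (u : Lp ℂ 2 (volume : Measure (Config n))) :
    Continuous fun a => phase (θ a) (hθ.comp (Continuous.prodMk_right a)) u := by
  rw [continuous_iff_continuousAt]
  intro a₀
  have hu := (Lp.memLp u).integrable_norm_rpow (by norm_num) (by norm_num)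
  simp only [ENNReal.toReal_ofNat, Real.rpow_ofNat] at hu
  have hm : ∀ a, AEStronglyMeasurable (fun v => ‖Complex.exp (Complex.I * θ a v) * u v -
      Complex.exp (Complex.I * θ a₀ v) * u v‖ ^ 2) (volume : Measure (Config n)) := fun a =>
    (((memLp_phase (hθ.comp (Continuous.prodMk_right a)) u).aestronglyMeasurable.sub
      (memLp_phase (hθ.comp (Continuous.prodMk_right a₀)) u).aestronglyMeasurable).norm.pow 2)
  have key : Continuous fun a => ∫ v, ‖Complex.exp (Complex.I * θ a v) * u v -
      Complex.exp (Complex.I * θ a₀ v) * u v‖ ^ 2 := by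
    refine continuous_of_dominated (bound := fun v => 4 * ‖u v‖ ^ 2) hm (fun a => ?_)
      (hu.const_mul 4) (Eventually.of_forall fun v => ?_)
    · refine Eventually.of_forall fun v => ?_
      rw [← sub_mul, norm_mul, Real.norm_of_nonneg (by positivity), mul_pow]
      have h2 : ‖Complex.exp (Complex.I * θ a v) - Complex.exp (Complex.I * θ a₀ v)‖ ≤ 2 := by
        refine (norm_sub_le _ _).trans ?_
        rw [mul_comm Complex.I, mul_comm Complex.I, Complex.norm_exp_ofReal_mul_I,
          Complex.norm_exp_ofReal_mul_I]
        norm_num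
      have h3 := norm_nonneg (Complex.exp (Complex.I * θ a v) - Complex.exp (Complex.I * θ a₀ v))
      gcongr
      nlinarith
    · have : Continuous fun a => θ a v := hθ.comp (Continuous.prodMk_left v)
      fun_prop
  have hn : ∀ a, ‖phase (θ a) (hθ.comp (Continuous.prodMk_right a)) u -
      phase (θ a₀) (hθ.comp (Continuous.prodMk_right a₀)) u‖ =
      Real.sqrt (∫ v, ‖Complex.exp (Complex.I * θ a v) * u v -
        Complex.exp (Complex.I * θ a₀ v) * u v‖ ^ 2) := by
    intro a
    rw [eq_comm, Real.sqrt_eq_iff_mul_self_eq (by positivity) (by positivity), ← sq]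
    have h := (Lp.memLp (phase (θ a) (hθ.comp (Continuous.prodMk_right a)) u -
      phase (θ a₀) (hθ.comp (Continuous.prodMk_right a₀)) u))
    rw [← inner_self_eq_norm_sq (𝕜 := ℂ), L2.inner_def, ← integral_re (L2.integrable_inner _ _)]
    refine integral_congr_ae ?_
    filter_upwards [coeFn_phase (hθ.comp (Continuous.prodMk_right a)) u,
      coeFn_phase (hθ.comp (Continuous.prodMk_right a₀)) u,
      Lp.coeFn_sub (phase (θ a) (hθ.comp (Continuous.prodMk_right a)) u)
        (phase (θ a₀) (hθ.comp (Continuous.prodMk_right a₀)) u)] with v h1 h2 h3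
    rw [h3, Pi.sub_apply, inner_self_eq_norm_sq]
    exact congrArg (fun z => ‖z‖ ^ 2) (congrArg₂ (· - ·) h1 h2).symm
  rw [ContinuousAt, tendsto_iff_norm_sub_tendsto_zero]
  simp only [hn]
  have := (key.sqrt).tendsto a₀
  simpa using this

/-- The translation operator `u(v) ↦ u(v + w)` on `L²(ℝⁿ)`. -/
def translate (w : Config n) :
    Lp ℂ 2 (volume : Measure (Config n)) →ₗᵢ[ℂ] Lp ℂ 2 (volume : Measure (Config n)) :=
  Lp.compMeasurePreservingₗᵢ ℂ (fun v => v + w) (measurePreserving_add_right volume w)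

theorem coeFn_translate (w : Config n) (u : Lp ℂ 2 (volume : Measure (Config n))) :
    translate w u =ᵐ[volume] fun v => u (v + w) :=
  Lp.coeFn_compMeasurePreserving u (measurePreserving_add_right volume w)

theorem continuous_translate (u : Lp ℂ 2 (volume : Measure (Config n))) :
    Continuous fun w : Config n => translate w u := by
  have hc : Continuous (fun p : Config n × Config n => p.2 + p.1) := by fun_prop
  exact Continuous.compMeasurePreservingLp (f := fun _ : Config n => u)
    (g := (ContinuousMap.mk _ hc).curry) continuous_const
    (ContinuousMap.curry _).continuous
    (fun w => measurePreserving_add_right volume w) (by norm_num)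

end Phase

/-! ## The quantum representations -/

section Quantum

variable {n : ℕ}

/-- The phase of the operator `π_μ(g)`. -/
def quantumPhase (μ : ℝ) (g : Heis n) (v : Config n) : ℝ :=
  μ * g.t + SignType.sign μ * √|μ| * ⟪g.x, v⟫ + μ * ⟪g.x, g.y⟫ / 2

theorem continuous_quantumPhase (μ : ℝ) :
    Continuous fun p : Heis n × Config n => quantumPhase μ p.1 p.2 := by
  have := Heis.continuous_t (n := n)
  have := Heis.continuous_x (n := n)
  have := Heis.continuous_y (n := n)
  unfold quantumPhase
  fun_prop

theorem continuous_quantumPhase_right (μ : ℝ) (g : Heis n) : Continuous (quantumPhase μ g) :=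
  (continuous_quantumPhase μ).comp (Continuous.prodMk_right g)

/-- The operator `π_μ(g)` on `L²(ℝⁿ)`. For `μ = ± λ` with `λ > 0` this is the unitary operator
`π_{±λ}(t, x, y) = exp i (± λ t ± λ^{1/2} x · M + λ^{1/2} y · D)`, with `M` the multiplication by
the coordinates and `D = -i ∂`; explicitly
`(π_{±λ}(t, x, y) u)(v) = exp i (± λ t ± λ^{1/2} x · v ± λ x · y / 2) u(v + λ^{1/2} y)`. -/
def quantumOp (μ : ℝ) (g : Heis n) :
    Lp ℂ 2 (volume : Measure (Config n)) →L[ℂ] Lp ℂ 2 (volume : Measure (Config n)) :=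
  ((phase (quantumPhase μ g) (continuous_quantumPhase_right μ g)).comp
    (translate (√|μ| • g.y))).toContinuousLinearMap

theorem coeFn_quantumOp (μ : ℝ) (g : Heis n) (u : Lp ℂ 2 (volume : Measure (Config n))) :
    quantumOp μ g u =ᵐ[volume]
      fun v => Complex.exp (Complex.I * quantumPhase μ g v) * u (v + √|μ| • g.y) := by
  filter_upwards [coeFn_phase (continuous_quantumPhase_right μ g) (translate (√|μ| • g.y) u),
    coeFn_translate (√|μ| • g.y) u] with v h1 h2
  rw [← h2, ← h1]
  rfl

/-- The infinite-dimensional representation `π_μ` of `ℍⁿ` on `L²(ℝⁿ)`; the Planck constant `μ` is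
to be non-zero. -/
def quantumRep (n : ℕ) (μ : ℝ) : UnitaryRep n (Lp ℂ 2 (volume : Measure (Config n))) where
  hom :=
    { toFun := quantumOp μ
      map_one' := by
        ext1 u
        apply Lp.ext
        filter_upwards [coeFn_quantumOp μ 1 u] with v h
        rw [h]
        simp [quantumPhase]
      map_mul' := fun g h => by
        ext1 u
        apply Lp.ext
        have h3 := (measurePreserving_add_right (volume : Measure (Config n))
          (√|μ| • g.y)).quasiMeasurePreserving.ae_eq_comp (coeFn_quantumOp μ h u)
        filter_upwards [coeFn_quantumOp μ (g * h) u,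
          coeFn_quantumOp μ g (quantumOp μ h u), h3] with v h1 h2 h3
        simp only [Function.comp_apply] at h3
        rw [h1]
        change _ = quantumOp μ g (quantumOp μ h u) v
        rw [h2, h3, ← mul_assoc, ← Complex.exp_add]
        have hs : (SignType.sign μ : ℝ) * √|μ| * √|μ| = μ := by
          rw [mul_assoc, Real.mul_self_sqrt (abs_nonneg μ), sign_mul_abs]
        congr 2
        · rw [← mul_add, ← Complex.ofReal_add]
          congr 2
          simp only [quantumPhase, Heis.mul_t, Heis.mul_x, Heis.mul_y, inner_add_left,
            inner_add_right, real_inner_smul_right, real_inner_comm h.x g.y]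
          linear_combination (-⟪h.x, g.y⟫) * hs
        · simp [add_assoc] }
  norm_map g u := LinearIsometry.norm_map _ u
  strongly_continuous u := by
    rw [continuous_iff_continuousAt]
    intro g₀
    rw [ContinuousAt, tendsto_iff_norm_sub_tendsto_zero]
    have h1 : Tendsto (fun g : Heis n => ‖translate (√|μ| • g.y) u - translate (√|μ| • g₀.y) u‖)
        (𝓝 g₀) (𝓝 0) := by
      rw [← tendsto_iff_norm_sub_tendsto_zero]
      exact ((continuous_translate u).comp (Heis.continuous_y.const_smul (√|μ|))).tendsto g₀
    have h2 : Tendsto (fun g : Heis n =>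
        ‖phase (quantumPhase μ g) (continuous_quantumPhase_right μ g) (translate (√|μ| • g₀.y) u) -
          phase (quantumPhase μ g₀) (continuous_quantumPhase_right μ g₀)
            (translate (√|μ| • g₀.y) u)‖) (𝓝 g₀) (𝓝 0) := by
      rw [← tendsto_iff_norm_sub_tendsto_zero]
      exact (continuous_phase (continuous_quantumPhase μ) _).tendsto g₀
    refine squeeze_zero (fun _ => norm_nonneg _) (fun g => ?_) (by simpa using h1.add h2)
    refine (norm_sub_le_norm_sub_add_norm_sub _
      (phase (quantumPhase μ g) (continuous_quantumPhase_right μ g)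
        (translate (√|μ| • g₀.y) u)) _).trans ?_
    refine add_le_add (le_of_eq ?_) le_rfl
    change ‖phase (quantumPhase μ g) (continuous_quantumPhase_right μ g)
      (translate (√|μ| • g.y) u) - _‖ = _
    rw [← map_sub, LinearIsometry.norm_map]

end Quantum

/-! ## Convolutions and the operator of two-sided convolution -/

section Convolution

variable {n : ℕ}

/-- The convolution `K = (2π)^{-N/2} ∫ k(g) π_l(g) dg` on `L²(ℍⁿ)` with kernel `k`. -/
def leftConv (k : Heis n → ℂ) : Lp ℂ 2 (haar n) →L[ℂ] Lp ℂ 2 (haar n) :=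
  (leftRegular n).integrated k

/-- The image `π_μ[k] = (2π)^{-N/2} ∫ k(g) π_μ(g) dg` of the convolution with kernel `k` under the
quantum representation with Planck constant `μ`. -/
def quantumImage (μ : ℝ) (k : Heis n → ℂ) :
    Lp ℂ 2 (volume : Measure (Config n)) →L[ℂ] Lp ℂ 2 (volume : Measure (Config n)) :=
  (quantumRep n μ).integrated k

/-- The commutator `[A, B] = A B - B A`. -/
def opComm {E : Type*} [NormedAddCommGroup E] [NormedSpace ℂ E] (A B : E →L[ℂ] E) : E →L[ℂ] E :=
  A ∘L B - B ∘L A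

/-- The two-sided convolution of `k` with the kernel `a(g, g₁)`, taken with respect to the measure
`α` in the variable `g₁` of the left shift and `β` in the variable `g` of the right shift:
`h ↦ ∫ ∫ a(g, g₁) k(g₁⁻¹ * h * g) dβ(g) dα(g₁)`. -/
def twoSided (α β : Measure (Heis n)) (a : Heis n → Heis n → ℂ) (k : Heis n → ℂ) (h : Heis n) : ℂ :=
  ∫ g₁, ∫ g, a g g₁ * k (g₁⁻¹ * h * g) ∂β ∂α

/-- The operator `H̃` of two-sided convolution with the kernel
`j̃(g, g₁) = δ(g) j(g₁) - j(g⁻¹) δ(g₁)`, acting on kernels of convolutions; `δ` is the Dirac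
function with respect to the normalised Haar measure. -/
def tildeH (j k : Heis n → ℂ) (h : Heis n) : ℂ :=
  twoSided (haar n) (Measure.dirac 1) (fun _ g₁ => j g₁) k h -
    twoSided (Measure.dirac 1) (haar n) (fun g _ => j g⁻¹) k h

end Convolution

/-! ## The main equation -/

section MainEquation

variable {n : ℕ}

/-- `f'` is the derivative `∂f/∂t` in the central coordinate, in the sense of distributions. -/
def HasCentralDeriv (f f' : Heis n → ℂ) : Prop :=
  ∀ φ : Heis n → ℂ, ContDiff ℝ ∞ φ → HasCompactSupport φ →
    ∫ g, f g * fderiv ℝ φ g (Heis.mk 1 0 0) ∂haar n = -∫ g, f' g * φ g ∂haar n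

/-- For the Fourier transform `∫ e^{iτs} f(s) ds`, with the same sign of the exponent as in the
representations, the operator `i d/ds` is the multiplication by the variable `τ` dual to the
time `s`. -/
theorem dual_of_time {f f' : ℝ → ℂ} (hf : ∀ s, HasDerivAt f (f' s) s) (hi : Integrable f)
    (hi' : Integrable f') (τ : ℝ) :
    ∫ s : ℝ, Complex.exp (Complex.I * τ * s) * (Complex.I * f' s) =
      τ * ∫ s : ℝ, Complex.exp (Complex.I * τ * s) * f s := by
  have he : ∀ s : ℝ, HasDerivAt (fun s : ℝ => Complex.exp (Complex.I * τ * s))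
      (Complex.I * τ * Complex.exp (Complex.I * τ * s)) s := by
    intro s
    have h := ((hasDerivAt_id s).ofReal_comp.const_mul (Complex.I * τ)).cexp
    simpa [mul_comm] using h
  have hb : ∀ g : ℝ → ℂ, Integrable g →
      Integrable fun s : ℝ => Complex.exp (Complex.I * τ * s) * g s := by
    intro g hg
    refine hg.norm.mono' (Continuous.aestronglyMeasurable (by fun_prop) |>.mul
      hg.aestronglyMeasurable) (Eventually.of_forall fun s => ?_)
    rw [norm_mul, mul_assoc, mul_comm Complex.I, ← Complex.ofReal_mul,
      Complex.norm_exp_ofReal_mul_I, one_mul]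
  have h := integral_mul_deriv_eq_deriv_mul_of_integrable
    (u := fun s : ℝ => Complex.exp (Complex.I * τ * s)) (v := f) (fun s _ => he s)
    (fun s _ => hf s) (hb _ hi')
    (by simpa [Pi.mul_def, mul_assoc] using (hb _ hi).const_mul (Complex.I * τ)) (hb _ hi)
  calc _ = Complex.I * ∫ s : ℝ, Complex.exp (Complex.I * τ * s) * f' s := by
        rw [← integral_const_mul]; congr 1; funext s; ring
    _ = _ := by
        rw [h]
        simp only [mul_assoc]
        rw [integral_const_mul, integral_const_mul]
        linear_combination (-(τ * ∫ s : ℝ, Complex.exp (Complex.I * (τ * s)) * f s)) *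
          Complex.I_mul_I

/-- `ℓ` is the kernel of `i τ ∂K/∂t` at time `s`, where `K(s)` is the convolution with kernel
`k(s) ∈ L¹(ℍⁿ)`. Here `t` is the central coordinate of the group, and `τ` is the variable dual to
the time `s`, that is, the operator `i ∂/∂s`; the time derivative is taken in `L¹(ℍⁿ)`. -/
def IsTauCentralDeriv (k : ℝ → Kernels n) (s : ℝ) (ℓ : Heis n → ℂ) : Prop :=
  DifferentiableAt ℝ k s ∧ Integrable ℓ (haar n) ∧
    HasCentralDeriv (fun g => Complex.I * (Complex.I * deriv k s g)) ℓ

/-- The main equation `i τ ∂K/∂t = - H̃ K` at time `s`. -/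
def MainEquationAt (j : Kernels n) (k : ℝ → Kernels n) (s : ℝ) : Prop :=
  IsTauCentralDeriv k s (fun h => -tildeH j (k s) h)

end MainEquation

/-! ## The classical map -/

section Classical

variable {n : ℕ}

/-- The one-dimensional representation `π_{(q,p)}(t, x, y) = e^{i(q · x + p · y)}`. -/
def classicalRep (q p : Config n) : UnitaryRep n ℂ where
  hom :=
    { toFun := fun g =>
        Complex.exp (Complex.I * (⟪q, g.x⟫ + ⟪p, g.y⟫ : ℝ)) • ContinuousLinearMap.id ℂ ℂ
      map_one' := by ext; simp
      map_mul' := fun g h => by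
        ext
        change Complex.exp _ * 1 = Complex.exp _ * (Complex.exp _ * 1)
        rw [mul_one, mul_one, ← Complex.exp_add]
        simp only [Heis.mul_x, Heis.mul_y, inner_add_right]
        congr 1
        push_cast
        ring }
  norm_map g u := by
    change ‖Complex.exp (Complex.I * (⟪q, g.x⟫ + ⟪p, g.y⟫ : ℝ)) * u‖ = ‖u‖
    rw [norm_mul, mul_comm Complex.I, Complex.norm_exp_ofReal_mul_I, one_mul]
  strongly_continuous u := by
    have := Heis.continuous_x (n := n)
    have := Heis.continuous_y (n := n)
    change Continuous fun g : Heis n =>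
      Complex.exp (Complex.I * (⟪q, g.x⟫ + ⟪p, g.y⟫ : ℝ)) * u
    fun_prop

/-- The classical map `π₀`: the convolution with kernel `k` is sent to the function
`(q, p) ↦ π_{(q,p)}[k]` on the phase space. -/
def classicalMap (k : Heis n → ℂ) (z : Config n × Config n) : ℂ :=
  (classicalRep z.1 z.2).integrated k 1

/-- The Fourier transform `k̂(μ, q, p) = (2π)^{-N/2} ∫ e^{i(μ t + q · x + p · y)} k(t, x, y) dg`. -/
def hat (k : Heis n → ℂ) (μ : ℝ) (z : Config n × Config n) : ℂ :=
  ∫ g, Complex.exp (Complex.I * (μ * g.t + ⟪z.1, g.x⟫ + ⟪z.2, g.y⟫ : ℝ)) * k g ∂haar n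

/-- The classical map evaluates the Fourier transform at the Planck constant `0`. -/
theorem classicalMap_eq_hat {k : Heis n → ℂ} (hk : Integrable k (haar n)) (z : Config n × Config n) :
    classicalMap k z = hat k 0 z := by
  rw [classicalMap, UnitaryRep.integrated_apply _ hk, hat]
  congr 1
  funext g
  rw [zero_mul, zero_add, smul_eq_mul, mul_comm]
  congr 1
  exact mul_one _

/-- `a` is the classical image of a kernel `f` which vanishes to first order in the Planck constant
(such as the kernel of a commutator): the limit of `μ⁻¹ f̂(μ, q, p)` as `μ → 0`. -/
def HasClassicalImage (f : Heis n → ℂ) (a : Config n × Config n → ℂ) : Prop :=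
  ∀ z, Tendsto (fun μ : ℝ => (μ : ℂ)⁻¹ * hat f μ z) (𝓝[≠] 0) (𝓝 (a z))

/-- The Poisson bracket `{F, G} = ∑ᵢ (∂F/∂qᵢ ∂G/∂pᵢ - ∂F/∂pᵢ ∂G/∂qᵢ)` on the phase space. -/
def poisson (F G : Config n × Config n → ℂ) (z : Config n × Config n) : ℂ :=
  ∑ i, (fderiv ℝ F z (EuclideanSpace.single i 1, 0) * fderiv ℝ G z (0, EuclideanSpace.single i 1) -
    fderiv ℝ F z (0, EuclideanSpace.single i 1) * fderiv ℝ G z (EuclideanSpace.single i 1, 0))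

/-- The first moments of `f` in the variables `(x, y)` are finite. -/
def HasFirstMoments (f : Heis n → ℂ) : Prop :=
  Integrable (fun g => (‖g.x‖ + ‖g.y‖) * ‖f g‖) (haar n)

end Classical

end PlainMechanics

end

open PlainMechanics

noncomputable section

namespace PlainMechanics

/-! ### The convolution algebra `L¹(ℍⁿ)` and integrated representations. -/

section GroupConvolution

variable {n : ℕ} {E : Type*} [NormedAddCommGroup E] [NormedSpace ℂ E]

/-! The two sides of the main equation are transformed separately, and the results are compared.

Right side: a substitution in the Haar integral gives `tildeH j k = j ⋆ k - k ⋆ j` (`tildeH_eq`),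
and integration against a unitary representation turns `⋆` into composition
(`UnitaryRep.integrated_conv`). So every representation sends `tildeH j k` to a commutator: the left
regular one yields the first claim, `π_μ` the Heisenberg bracket.

Left side: since `τ = i ∂/∂s`, the operator `i τ ∂/∂t` is `-∂/∂s ∂/∂t`. Paired with a bounded
function of central frequency `μ`, that is `e^{iμt}` times a function of `(x, y)`, the operator
`∂/∂t` becomes `-iμ`, so `i τ ∂k/∂t` contributes `iμ` times the pairing with `∂k/∂s`
(`HasCentralDeriv.integral_smul`). Such functions are not test functions: a widening cut-off in `t`
and the fundamental lemma of the calculus of variations in `(x, y)` bridge the gap. Both `g ↦ π_μ(g)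
u` and the exponentials in `hat` have this form. For `μ ≠ 0`, dividing by `iμ` gives the Heisenberg
equation.

Classical limit: `hat (tildeH j k)` is the integral of `j(a) k(b)` against the difference of one
exponential at `ab` and at `ba`. These points differ by the central element `y · x' - x · y'`, so
the difference is `O(μ)`. Its quotient by `μ` is dominated by means of the first moments and tends
to the symplectic form times `e^{i(q·x+p·y)}` at both points. As derivatives of `classicalMap` bring
down the factors `i x`, `i y`, the limit is a Poisson bracket (`integral_symplectic`). Uniqueness of
the limit of `μ⁻¹ hat` gives the Hamilton equation. -/

instance : MeasurableMul₂ (Heis n) := ⟨Heis.continuous_mul.measurable⟩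
instance : MeasurableInv (Heis n) := ⟨Heis.continuous_inv.measurable⟩
instance : (haar n).IsMulLeftInvariant := ⟨fun g => (measurePreserving_mul_left g).map_eq⟩

/-- The convolution `(f ⋆ g)(h) = ∫ f(a) g(a⁻¹ * h) dν(a)` of two kernels. -/
def conv (f g : Heis n → ℂ) (h : Heis n) : ℂ :=
  ∫ a, f a * g (a⁻¹ * h) ∂haar n

/-- The Dirac measures remove one integral from each term. The first term is then `conv j k`; the
second becomes `conv k j` under the left translation `g ↦ h * g`. -/
theorem tildeH_eq (j k : Heis n → ℂ) : tildeH j k = fun h => conv j k h - conv k j h := by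
  funext h
  have h1 := integral_mul_left_eq_self (μ := haar n) (fun a => k a * j (a⁻¹ * h)) h
  simp only [mul_inv_rev, mul_assoc, inv_mul_cancel, mul_one] at h1
  simp only [tildeH, twoSided, integral_dirac, conv, mul_one, inv_one, one_mul]
  rw [← h1]
  simp only [mul_comm]

/-- By left invariance the shear `(a, h) ↦ (a, a⁻¹ * h)` preserves the product measure, and it
carries `f ⊗ g` to this integrand. -/
theorem integrable_conv_integrand {f g : Heis n → ℂ} (hf : Integrable f (haar n))
    (hg : Integrable g (haar n)) :
    Integrable (fun p : Heis n × Heis n => f p.1 * g (p.1⁻¹ * p.2))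
      ((haar n).prod (haar n)) :=
  (measurePreserving_prod_inv_mul (haar n) (haar n)).integrable_comp_of_integrable
    (hf.mul_prod hg)

theorem integrable_conv {f g : Heis n → ℂ} (hf : Integrable f (haar n))
    (hg : Integrable g (haar n)) : Integrable (conv f g) (haar n) :=
  (integrable_conv_integrand hf hg).integral_prod_right

theorem Integrable.smul_of_norm_le {X : Type*} [MeasurableSpace X] {μ : Measure X} {f : X → ℂ}
    {Φ : X → E} (hf : Integrable f μ) (hΦ : AEStronglyMeasurable Φ μ) {C : ℝ}
    (hC : ∀ x, ‖Φ x‖ ≤ C) : Integrable (fun x => f x • Φ x) μ := by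
  refine (hf.norm.mul_const C).mono' (hf.aestronglyMeasurable.smul hΦ)
    (Eventually.of_forall fun x => ?_)
  rw [norm_smul]
  exact mul_le_mul_of_nonneg_left (hC x) (norm_nonneg _)

/-- Fubini and the shear `(a, b) ↦ (a, a * b)`. No multiplicativity of `Φ` is required, so this
serves both for `Φ = ρ(·) u` and for the exponentials in `hat`, which are not characters of `ℍⁿ`
when `μ ≠ 0` and `n > 0`. -/
theorem integral_conv_smul [CompleteSpace E] {f g : Heis n → ℂ} (hf : Integrable f (haar n))
    (hg : Integrable g (haar n)) {Φ : Heis n → E} (hΦ : Continuous Φ) {C : ℝ}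
    (hC : ∀ h, ‖Φ h‖ ≤ C) :
    ∫ h, conv f g h • Φ h ∂haar n =
      ∫ p : Heis n × Heis n, (f p.1 * g p.2) • Φ (p.1 * p.2) ∂(haar n).prod (haar n) := by
  have hi : Integrable (fun p : Heis n × Heis n => (f p.1 * g (p.1⁻¹ * p.2)) • Φ p.2)
      ((haar n).prod (haar n)) :=
    Integrable.smul_of_norm_le (integrable_conv_integrand hf hg)
      (hΦ.comp continuous_snd).aestronglyMeasurable fun p => hC p.2
  calc ∫ h, conv f g h • Φ h ∂haar n
      = ∫ h, ∫ a, (f a * g (a⁻¹ * h)) • Φ h ∂haar n ∂haar n := by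
        simp only [conv, integral_smul_const]
    _ = ∫ p : Heis n × Heis n, (f p.1 * g (p.1⁻¹ * p.2)) • Φ p.2 ∂(haar n).prod (haar n) :=
        (integral_prod_symm _ hi).symm
    _ = _ := by
        have h1 := (measurePreserving_prod_mul (haar n) (haar n)).integral_comp
          (MeasurableEquiv.shearMulRight (Heis n)).measurableEmbedding
          (fun p : Heis n × Heis n => (f p.1 * g (p.1⁻¹ * p.2)) • Φ p.2)
        rw [← h1]
        simp

theorem UnitaryRep.integrated_conv [CompleteSpace E] (ρ : UnitaryRep n E) {f g : Heis n → ℂ}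
    (hf : Integrable f (haar n)) (hg : Integrable g (haar n)) :
    ρ.integrated (conv f g) = ρ.integrated f ∘L ρ.integrated g := by
  ext1 u
  rw [ContinuousLinearMap.comp_apply, ρ.integrated_apply (integrable_conv hf hg),
    integral_conv_smul hf hg (ρ.strongly_continuous u) (fun h => (ρ.norm_map h u).le),
    ρ.integrated_apply hf, integral_prod]
  · refine integral_congr_ae (Eventually.of_forall fun a => ?_)
    simp only
    rw [ρ.integrated_apply hg, ← (ρ.hom a).integral_comp_comm (ρ.integrable hg u),
      ← integral_smul]
    refine integral_congr_ae (Eventually.of_forall fun b => ?_)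
    simp [mul_smul]
  · exact Integrable.smul_of_norm_le (hf.mul_prod hg)
      ((ρ.strongly_continuous u).comp Heis.continuous_mul).aestronglyMeasurable
      fun p => (ρ.norm_map _ u).le

theorem UnitaryRep.integrated_sub (ρ : UnitaryRep n E) {f g : Heis n → ℂ}
    (hf : Integrable f (haar n)) (hg : Integrable g (haar n)) :
    ρ.integrated (fun h => f h - g h) = ρ.integrated f - ρ.integrated g := by
  ext1 u
  rw [sub_apply, ρ.integrated_apply hf, ρ.integrated_apply hg,
    ρ.integrated_apply (f := fun h => f h - g h) (hf.sub hg),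
    ← integral_sub (ρ.integrable hf u) (ρ.integrable hg u)]
  simp only [sub_smul]

theorem UnitaryRep.integrated_neg (ρ : UnitaryRep n E) {f : Heis n → ℂ}
    (hf : Integrable f (haar n)) : ρ.integrated (fun h => -f h) = -ρ.integrated f := by
  ext1 u
  rw [neg_apply, ρ.integrated_apply hf, ρ.integrated_apply hf.fun_neg,
    ← integral_neg]
  simp only [neg_smul]

theorem UnitaryRep.integrated_congr (ρ : UnitaryRep n E) {f g : Heis n → ℂ}
    (hf : Integrable f (haar n)) (hfg : f =ᵐ[haar n] g) : ρ.integrated f = ρ.integrated g := by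
  ext1 u
  rw [ρ.integrated_apply hf, ρ.integrated_apply (hf.congr hfg)]
  exact integral_congr_ae (hfg.mono fun h hh => by simp only [hh])

theorem integrable_tildeH {j k : Heis n → ℂ} (hj : Integrable j (haar n))
    (hk : Integrable k (haar n)) : Integrable (tildeH j k) (haar n) := by
  rw [tildeH_eq]
  exact (integrable_conv hj hk).sub (integrable_conv hk hj)

theorem UnitaryRep.integrated_tildeH [CompleteSpace E] (ρ : UnitaryRep n E) {j k : Heis n → ℂ}
    (hj : Integrable j (haar n)) (hk : Integrable k (haar n)) :
    ρ.integrated (tildeH j k) = opComm (ρ.integrated j) (ρ.integrated k) := by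
  rw [tildeH_eq, ρ.integrated_sub (integrable_conv hj hk) (integrable_conv hk hj),
    ρ.integrated_conv hj hk, ρ.integrated_conv hk hj, opComm]

theorem Kernels.integrable (k : Kernels n) : Integrable k (haar n) :=
  L1.integrable_coeFn k

theorem UnitaryRep.norm_integrated_le (ρ : UnitaryRep n E) (k : Kernels n) :
    ‖ρ.integrated k‖ ≤ ‖k‖ := by
  refine ContinuousLinearMap.opNorm_le_bound _ (norm_nonneg k) fun u => ?_
  rw [ρ.integrated_apply k.integrable, L1.norm_eq_integral_norm, ← integral_mul_const]
  refine (norm_integral_le_integral_norm _).trans (le_of_eq ?_)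
  simp only [norm_smul, ρ.norm_map]

/-- The integrated form as a continuous linear map on `L¹(ℍⁿ)`. -/
def UnitaryRep.integratedCLM (ρ : UnitaryRep n E) : Kernels n →L[ℝ] (E →L[ℂ] E) :=
  LinearMap.mkContinuous
    { toFun := fun k => ρ.integrated k
      map_add' := fun k l => by
        rw [ρ.integrated_congr (k + l).integrable (Lp.coeFn_add k l)]
        ext1 u
        rw [_root_.add_apply, ρ.integrated_apply k.integrable,
          ρ.integrated_apply l.integrable, ρ.integrated_apply (k.integrable.add l.integrable),
          ← integral_add (ρ.integrable k.integrable u) (ρ.integrable l.integrable u)]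
        simp only [Pi.add_apply, add_smul]
      map_smul' := fun c k => by
        rw [ρ.integrated_congr (c • k).integrable (Lp.coeFn_smul c k)]
        ext1 u
        rw [RingHom.id_apply, _root_.smul_apply, ρ.integrated_apply k.integrable,
          ρ.integrated_apply (k.integrable.smul c), ← integral_smul]
        simp only [Pi.smul_apply, smul_assoc] } 1
    (fun k => by rw [one_mul]; exact ρ.norm_integrated_le k)

/-- Integration is a linear contraction from `L¹` to the bounded operators, so a derivative in `L¹`
passes to the operator norm. -/
theorem UnitaryRep.hasDerivAt_integrated (ρ : UnitaryRep n E) {k : ℝ → Kernels n} {s : ℝ}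
    (hk : DifferentiableAt ℝ k s) :
    HasDerivAt (fun r => ρ.integrated (k r)) (ρ.integrated (deriv k s : Kernels n)) s :=
  ρ.integratedCLM.hasFDerivAt.comp_hasDerivAt s hk.hasDerivAt

end GroupConvolution

/-! ### The distributional central derivative against functions of a fixed central frequency. -/

section CentralDerivative

open Complex

variable {V : Type*} [NormedAddCommGroup V] [NormedSpace ℝ V] [FiniteDimensional ℝ V]
  [MeasureSpace V] [BorelSpace V]

/-- If an integrable function on `ℝ × V` is orthogonal to all test functions of the second
variable, then it is orthogonal to all bounded continuous functions of that variable. -/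
theorem integral_smul_snd_eq_zero [SigmaFinite (volume : Measure V)] {E : Type*} [NormedAddCommGroup E] [NormedSpace ℂ E]
    [CompleteSpace E] {D : ℝ × V → ℂ} (hD : Integrable D)
    (h : ∀ c : V → ℝ, ContDiff ℝ ∞ c → HasCompactSupport c → ∫ p, c p.2 • D p = 0)
    {Φ : V → E} (hΦ : Continuous Φ) {C : ℝ} (hC : ∀ v, ‖Φ v‖ ≤ C) :
    ∫ p, D p • Φ p.2 = 0 := by
  -- Pairing with a function of `v` alone sees only the marginal of `D`, and the fundamental lemma
  -- makes this marginal vanish almost everywhere.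
  have hm : ∀ᵐ v : V, ∫ t : ℝ, D (t, v) = 0 := by
    refine ae_eq_zero_of_integral_contDiff_smul_eq_zero
      (Integrable.integral_prod_right hD).locallyIntegrable fun c hc hc' => ?_
    rw [← h c hc hc']
    obtain ⟨M, hM⟩ := hc.continuous.bounded_above_of_compact_support hc'
    have hi : Integrable (fun p : ℝ × V => c p.2 • D p) :=
      hD.bdd_smul M (φ := fun p : ℝ × V => c p.2)
        (hc.continuous.comp continuous_snd).aestronglyMeasurable
        (Eventually.of_forall fun p => hM p.2)
    rw [Measure.volume_eq_prod, integral_prod_symm _ hi]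
    simp only [integral_smul]
  have hi : Integrable (fun p : ℝ × V => D p • Φ p.2) := Integrable.smul_of_norm_le hD
    (hΦ.comp continuous_snd).aestronglyMeasurable fun p => hC p.2
  rw [Measure.volume_eq_prod, integral_prod_symm _ hi, integral_eq_zero_of_ae]
  filter_upwards [hm] with v hv
  simp [integral_smul_const, hv]

/-- A smooth cut-off function in one variable. -/
theorem exists_cutoff : ∃ χ : ℝ → ℝ, ContDiff ℝ ∞ χ ∧ HasCompactSupport χ ∧ χ 0 = 1 := by
  let b : ContDiffBump (0 : ℝ) := ⟨1, 2, one_pos, one_lt_two⟩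
  exact ⟨b, b.contDiff, b.hasCompactSupport,
    b.one_of_mem_closedBall (Metric.mem_closedBall_self zero_le_one)⟩

/-- Test with `χ(εt) e^{iμt} c(v)` and let `ε → 0`: the derivative of the cut-off carries a factor
`ε` and disappears, that of the exponential gives `iμ`. -/
theorem integral_central_test {f ℓ : ℝ × V → ℂ} (hf : Integrable f) (hℓ : Integrable ℓ)
    (h : ∀ φ : ℝ × V → ℂ, ContDiff ℝ ∞ φ → HasCompactSupport φ →
      ∫ p, f p * fderiv ℝ φ p (1, 0) = -∫ p, ℓ p * φ p) (μ : ℝ)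
    {c : V → ℝ} (hc : ContDiff ℝ ∞ c) (hc' : HasCompactSupport c) :
    ∫ p, c p.2 • ((ℓ p + I * μ * f p) * exp (I * (μ * p.1 : ℝ))) = 0 := by
  obtain ⟨χ, hχ, hχ', hχ0⟩ := exists_cutoff
  obtain ⟨M, hM⟩ := hc.continuous.bounded_above_of_compact_support hc'
  obtain ⟨A, hA⟩ := hχ.continuous.bounded_above_of_compact_support hχ'
  have hdχ : Continuous (deriv χ) := hχ.continuous_deriv (by simp)
  obtain ⟨B, hB⟩ := hdχ.bounded_above_of_compact_support hχ'.deriv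
  have hM0 : 0 ≤ M := (norm_nonneg _).trans (hM 0)
  have hA0 : 0 ≤ A := (norm_nonneg _).trans (hA 0)
  have hexp : ∀ a : ℝ, ‖exp (I * a)‖ = 1 := fun a => by
    rw [mul_comm, norm_exp_ofReal_mul_I]
  -- the test functions
  let φ : ℝ → ℝ × V → ℂ := fun ε p => (χ (ε * p.1) : ℂ) * exp (I * (μ * p.1 : ℝ)) * (c p.2 : ℂ)
  have hφ : ∀ ε, ContDiff ℝ ∞ (φ ε) := fun ε => by
    refine ContDiff.mul (ContDiff.mul ?_ ?_) ?_
    · exact ofRealCLM.contDiff.comp (hχ.comp (contDiff_const.mul contDiff_fst))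
    · exact (contDiff_const.mul (ofRealCLM.contDiff.comp (contDiff_const.mul contDiff_fst))).cexp
    · exact ofRealCLM.contDiff.comp (hc.comp contDiff_snd)
  have hφ' : ∀ ε, ε ≠ 0 → HasCompactSupport (φ ε) := fun ε hε => by
    have h1 : HasCompactSupport (fun t => χ (ε * t)) := hχ'.comp_homeomorph (Homeomorph.mulLeft₀ ε hε)
    refine HasCompactSupport.intro (h1.prod hc') fun p hp => ?_
    rw [Set.mem_prod, not_and_or] at hp
    rcases hp with hp | hp
    · simp only [φ, image_eq_zero_of_notMem_tsupport hp]; simp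
    · simp only [φ, image_eq_zero_of_notMem_tsupport hp]; simp
  have hderiv : ∀ ε p, fderiv ℝ (φ ε) p (1, 0) =
      ((deriv χ (ε * p.1) * ε : ℝ) + χ (ε * p.1) * (I * μ)) * exp (I * (μ * p.1 : ℝ)) * c p.2 := by
    intro ε p
    -- Restricted to the line in direction `(1, 0)`, the Fréchet derivative is an ordinary
    -- derivative in which `c` is constant.
    have h1 : HasDerivAt (fun r : ℝ => φ ε (p + r • ((1 : ℝ), (0 : V)))) (fderiv ℝ (φ ε) p (1, 0)) 0 := by
      have h3 : HasDerivAt (fun r : ℝ => p + r • ((1 : ℝ), (0 : V))) (1, 0) 0 := by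
        simpa using ((hasDerivAt_id (0 : ℝ)).smul_const ((1 : ℝ), (0 : V))).const_add p
      have h2 := (((hφ ε).differentiable (by simp)) (p + (0 : ℝ) • ((1 : ℝ), (0 : V)))).hasFDerivAt
      simpa [Function.comp_def] using h2.comp_hasDerivAt (0 : ℝ) h3
    have h4 : HasDerivAt (fun r : ℝ => p.1 + r) 1 0 := (hasDerivAt_id (0 : ℝ)).const_add p.1
    have h5 : HasDerivAt (fun r : ℝ => χ (ε * (p.1 + r))) (deriv χ (ε * p.1) * ε) 0 := by
      have h6 := (((hχ.differentiable (by simp)) (ε * (p.1 + 0))).hasDerivAt).comp (0 : ℝ)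
        (h4.const_mul ε)
      simpa [Function.comp_def] using h6
    have h7 : HasDerivAt (fun r : ℝ => exp (I * (μ * (p.1 + r) : ℝ)))
        (exp (I * (μ * p.1 : ℝ)) * (I * μ)) 0 := by
      simpa using ((h4.const_mul μ).ofReal_comp.const_mul I).cexp
    have h8 := (h5.ofReal_comp.mul h7).mul_const (c p.2 : ℂ)
    have h9 : (fun r : ℝ => φ ε (p + r • ((1 : ℝ), (0 : V)))) = fun r : ℝ =>
        (χ (ε * (p.1 + r)) : ℂ) * exp (I * (μ * (p.1 + r) : ℝ)) * (c p.2 : ℂ) := by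
      funext r; simp [φ]
    rw [h9] at h1
    rw [h1.unique h8, add_zero]
    ring
  -- the limit of the identities for the test functions
  let ε : ℕ → ℝ := fun m => 1 / ((m : ℝ) + 1)
  have hε0 : ∀ m, 0 < ε m := fun m => Nat.one_div_pos_of_nat
  have hε1 : ∀ m, ε m ≤ 1 := fun m => by
    rw [div_le_one (by positivity)]; simp
  have hεlim : Tendsto ε atTop (𝓝 0) := tendsto_one_div_add_atTop_nhds_zero_nat
  have hεt : ∀ t : ℝ, Tendsto (fun m => ε m * t) atTop (𝓝 0) := fun t => by
    simpa using hεlim.mul_const t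
  have hχt : ∀ t : ℝ, Tendsto (fun m => (χ (ε m * t) : ℂ)) atTop (𝓝 1) := fun t => by
    have := ((continuous_ofReal.comp hχ.continuous).tendsto 0).comp (hεt t)
    simpa [hχ0, Function.comp_def] using this
  have hdχt : ∀ t : ℝ, Tendsto (fun m => ((deriv χ (ε m * t) * ε m : ℝ) : ℂ)) atTop (𝓝 0) :=
    fun t => by
    have := (((hdχ.tendsto 0).comp (hεt t)).mul hεlim).ofReal
    simpa [Function.comp_def] using this
  have hcn : ∀ v, ‖(c v : ℂ)‖ ≤ M := fun v => by rw [norm_real]; exact hM v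
  -- The summand `0` is the limit of the cut-off's derivative and the factor `1` that of the
  -- cut-off. The majorant uses `ε m ≤ 1`.
  have hL : Tendsto (fun m => ∫ p, f p * fderiv ℝ (φ (ε m)) p (1, 0)) atTop
      (𝓝 (∫ p, f p * ((0 + 1 * (I * μ)) * exp (I * (μ * p.1 : ℝ)) * c p.2))) := by
    refine tendsto_integral_of_dominated_convergence (fun p => ‖f p‖ * ((B + A * |μ|) * 1 * M))
      (fun m => ?_) (hf.norm.mul_const _) (fun m => ?_) ?_
    · refine hf.aestronglyMeasurable.mul (Continuous.aestronglyMeasurable ?_)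
      exact ((hφ _).continuous_fderiv (by simp)).clm_apply continuous_const
    · refine Eventually.of_forall fun p => ?_
      rw [hderiv, norm_mul, norm_mul, norm_mul, hexp]
      have h1 : ‖((deriv χ (ε m * p.1) * ε m : ℝ) + χ (ε m * p.1) * (I * μ) : ℂ)‖ ≤ B + A * |μ| := by
        refine (norm_add_le _ _).trans (add_le_add ?_ ?_)
        · rw [norm_real, norm_mul, Real.norm_of_nonneg (hε0 m).le]
          exact (mul_le_of_le_one_right (norm_nonneg _) (hε1 m)).trans (hB _)
        · rw [norm_mul, norm_mul, norm_I, one_mul, norm_real, norm_real, Real.norm_eq_abs μ]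
          exact mul_le_mul_of_nonneg_right (hA _) (abs_nonneg μ)
      have hcp := hcn p.2
      gcongr
      exact mul_nonneg ((norm_nonneg _).trans h1) zero_le_one
    · refine Eventually.of_forall fun p => ?_
      simp only [hderiv]
      exact ((((hdχt p.1).add ((hχt p.1).mul_const _)).mul_const _).mul_const _).const_mul _
  have hR : Tendsto (fun m => -∫ p, ℓ p * φ (ε m) p) atTop
      (𝓝 (-∫ p, ℓ p * (1 * exp (I * (μ * p.1 : ℝ)) * c p.2))) := by
    refine (tendsto_integral_of_dominated_convergence (fun p => ‖ℓ p‖ * (A * 1 * M))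
      (fun m => ?_) (hℓ.norm.mul_const _) (fun m => ?_) ?_).neg
    · exact hℓ.aestronglyMeasurable.mul (hφ _).continuous.aestronglyMeasurable
    · refine Eventually.of_forall fun p => ?_
      simp only [φ]
      rw [norm_mul, norm_mul, norm_mul, hexp, norm_real]
      gcongr
      exacts [hA _, hcn _]
    · exact Eventually.of_forall fun p =>
        (((hχt p.1).mul_const _).mul_const _).const_mul _
  have hEq := tendsto_nhds_unique hL
    (hR.congr fun m => (h _ (hφ _) (hφ' _ (hε0 m).ne')).symm)
  have hb : ∀ {u : ℝ × V → ℂ}, Integrable u → ∀ a : ℂ,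
      Integrable fun p => u p * (a * exp (I * (μ * p.1 : ℝ)) * c p.2) := by
    intro u hu a
    have hcont : Continuous fun p : ℝ × V => a * exp (I * (μ * p.1 : ℝ)) * c p.2 := by
      have := hc.continuous
      fun_prop
    refine hu.mul_bdd (c := ‖a‖ * M) hcont.aestronglyMeasurable (Eventually.of_forall fun p => ?_)
    rw [norm_mul, norm_mul, hexp, mul_one]
    gcongr
    exact hcn _
  rw [eq_neg_iff_add_eq_zero, ← integral_add (hb hf _) (hb hℓ _)] at hEq
  rw [← hEq]
  refine integral_congr_ae (Eventually.of_forall fun p => ?_)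
  simp only [real_smul]
  ring

/-- The density `(2π)^{-N/2}` of the normalised Haar measure. -/
def haarDensity (n : ℕ) : ℝ := (2 * Real.pi) ^ (-((2 * n + 1 : ℝ) / 2))

theorem haarDensity_pos (n : ℕ) : 0 < haarDensity n := by
  unfold haarDensity; positivity

theorem integral_haar_eq {n : ℕ} {F : Type*} [NormedAddCommGroup F] [NormedSpace ℝ F]
    (u : ℝ × Config n × Config n → F) :
    (∫ g, u g ∂haar n) = haarDensity n • ∫ p, u p := by
  refine (integral_smul_measure (μ := (volume : Measure (ℝ × Config n × Config n))) u _).trans ?_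
  rw [ENNReal.toReal_ofReal (by positivity), haarDensity]

/-- The central derivative acts on a kernel with central frequency `μ` as the multiplication by
`-i μ`. -/
theorem HasCentralDeriv.integral_smul {n : ℕ} {E : Type*} [NormedAddCommGroup E]
    [NormedSpace ℂ E] [CompleteSpace E] {f ℓ : Heis n → ℂ} (h : HasCentralDeriv f ℓ)
    (hf : Integrable f (haar n)) (hℓ : Integrable ℓ (haar n)) (μ : ℝ) {Φ : Heis n → E}
    (hΦ : Continuous Φ) {C : ℝ} (hC : ∀ g, ‖Φ g‖ ≤ C)
    (hμ : ∀ g, Φ g = exp (I * (μ * g.t : ℝ)) • Φ (Heis.mk 0 g.x g.y)) :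
    ∫ g, ℓ g • Φ g ∂haar n = -(I * μ) • ∫ g, f g • Φ g ∂haar n := by
  have hr := haarDensity_pos n
  have hr0 : ENNReal.ofReal (haarDensity n) ≠ 0 := by simpa using hr
  have hinteg : ∀ {u : ℝ × Config n × Config n → ℂ}, Integrable u (haar n) →
      Integrable u (volume : Measure (ℝ × Config n × Config n)) := fun hu =>
    (integrable_smul_measure hr0 ENNReal.ofReal_ne_top).1 hu
  have hf' := hinteg hf
  have hℓ' := hinteg hℓ
  -- Both sides carry the same positive density, which cancels on passing to Lebesgue measure.
  have htest : ∀ φ : ℝ × Config n × Config n → ℂ, ContDiff ℝ ∞ φ → HasCompactSupport φ →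
      ∫ p : ℝ × Config n × Config n, f p * fderiv ℝ φ p (1, 0) =
        -∫ p : ℝ × Config n × Config n, ℓ p * φ p := by
    intro φ h1 h2
    have h3 := h φ h1 h2
    have h4 : haarDensity n • ∫ p : ℝ × Config n × Config n, f p * fderiv ℝ φ p (1, 0) =
        -(haarDensity n • ∫ p : ℝ × Config n × Config n, ℓ p * φ p) := by
      rw [← integral_haar_eq, ← integral_haar_eq]
      exact h3
    rw [← smul_neg] at h4
    exact smul_right_injective _ hr.ne' h4
  have hexp : ∀ a : ℝ, ‖exp (I * a)‖ = 1 := fun a => by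
    rw [mul_comm, norm_exp_ofReal_mul_I]
  -- The factor `e^{iμt}` of `Φ` is moved into `D`, so that what remains of `Φ` depends on `(x, y)`
  -- only.
  have key := integral_smul_snd_eq_zero
    (D := fun p => (ℓ p + I * μ * f p) * exp (I * (μ * p.1 : ℝ)))
    (Φ := fun v : Config n × Config n => Φ (Heis.mk 0 v.1 v.2)) (C := C) ?_
    (fun c hc hc' => integral_central_test hf' hℓ' htest μ hc hc')
    (hΦ.comp (continuous_const.prodMk continuous_id : Continuous fun v : Config n × Config n =>
      ((0 : ℝ), v)))
    (fun v => hC _)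
  · have hi : ∀ {u : Heis n → ℂ}, Integrable u (haar n) →
        Integrable (fun g => u g • Φ g) (haar n) := fun hu =>
      Integrable.smul_of_norm_le hu hΦ.aestronglyMeasurable hC
    rw [neg_smul, eq_neg_iff_add_eq_zero, ← MeasureTheory.integral_smul,
      ← integral_add (hi hℓ) ((hi hf).fun_smul _), ← smul_zero (haarDensity n), ← key,
      ← integral_haar_eq]
    refine integral_congr_ae (Eventually.of_forall fun g => ?_)
    change ℓ g • Φ g + (I * μ) • f g • Φ g =
      ((ℓ g + I * μ * f g) * exp (I * (μ * g.t : ℝ))) • Φ (Heis.mk 0 g.x g.y)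
    rw [hμ g, smul_smul, smul_smul, smul_smul, ← add_smul]
    congr 1
    ring
  · refine (hℓ'.add (hf'.const_mul (I * μ))).mul_bdd (c := 1)
      (Continuous.aestronglyMeasurable (by fun_prop)) (Eventually.of_forall fun p => (hexp _).le)

end CentralDerivative

/-! ### The main equation in the quantum representations. -/

section Quantum

open Complex

variable {n : ℕ}

/-- The centre acts by the scalars `e^{iμt}`; this is the fixed central frequency which
`HasCentralDeriv.integral_smul` asks for. -/
theorem quantumRep_hom_eq (μ : ℝ) (u : Lp ℂ 2 (volume : Measure (Config n))) (g : Heis n) :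
    (quantumRep n μ).hom g u =
      exp (I * (μ * g.t : ℝ)) • (quantumRep n μ).hom (Heis.mk 0 g.x g.y) u := by
  apply Lp.ext
  change quantumOp μ g u =ᵐ[volume] ⇑(exp (I * (μ * g.t : ℝ)) • quantumOp μ (Heis.mk 0 g.x g.y) u)
  filter_upwards [coeFn_quantumOp μ g u, coeFn_quantumOp μ (Heis.mk 0 g.x g.y) u,
    Lp.coeFn_smul (exp (I * (μ * g.t : ℝ))) (quantumOp μ (Heis.mk 0 g.x g.y) u)] with v h1 h2 h3
  rw [h1, h3, Pi.smul_apply, h2, smul_eq_mul, ← mul_assoc, ← exp_add]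
  congr 2
  simp only [quantumPhase, Heis.t_mk, Heis.x_mk, Heis.y_mk]
  push_cast
  ring

/-- The factor `i · i = -1` from `i τ` cancels the sign of the integration by parts, leaving `+iμ`.
-/
theorem IsTauCentralDeriv.integral_smul {E : Type*} [NormedAddCommGroup E] [NormedSpace ℂ E]
    [CompleteSpace E] {k : ℝ → Kernels n} {s : ℝ} {ℓ : Heis n → ℂ} (h : IsTauCentralDeriv k s ℓ)
    (μ : ℝ) {Φ : Heis n → E} (hΦ : Continuous Φ) {C : ℝ} (hC : ∀ g, ‖Φ g‖ ≤ C)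
    (hμ : ∀ g, Φ g = exp (I * (μ * g.t : ℝ)) • Φ (Heis.mk 0 g.x g.y)) :
    ∫ g, ℓ g • Φ g ∂haar n = (I * μ) • ∫ g, deriv k s g • Φ g ∂haar n := by
  have h1 : (fun g => I * (I * deriv k s g)) = fun g => -deriv k s g := by
    funext g
    rw [← mul_assoc, I_mul_I, neg_one_mul]
  have h2 := h.2.2
  rw [h1] at h2
  rw [h2.integral_smul (Kernels.integrable (deriv k s)).fun_neg h.2.1 μ hΦ hC hμ]
  simp only [neg_smul, integral_neg, smul_neg, neg_neg]

theorem IsTauCentralDeriv.quantumImage_eq {k : ℝ → Kernels n} {s : ℝ} {ℓ : Heis n → ℂ}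
    (h : IsTauCentralDeriv k s ℓ) (μ : ℝ) :
    quantumImage μ ℓ = (I * μ) • deriv (fun r => quantumImage μ (k r)) s := by
  have hd : HasDerivAt (fun r => quantumImage μ (k r)) (quantumImage μ (deriv k s : Kernels n)) s :=
    (quantumRep n μ).hasDerivAt_integrated h.1
  rw [hd.deriv]
  ext1 u
  rw [_root_.smul_apply, quantumImage, quantumImage, (quantumRep n μ).integrated_apply h.2.1,
    (quantumRep n μ).integrated_apply (Kernels.integrable (deriv k s))]
  exact h.integral_smul μ ((quantumRep n μ).strongly_continuous u)
    (fun g => ((quantumRep n μ).norm_map g u).le) (quantumRep_hom_eq μ u)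

end Quantum

/-! ### Derivatives of the classical map and the limit `μ → 0`. -/

section ClassicalLimit

open Complex

variable {n : ℕ}

/-- The linear form `(q, p) ↦ q · x + p · y` on the phase space. -/
def phaseForm (g : Heis n) : Config n × Config n →L[ℝ] ℝ :=
  (innerSL ℝ g.x).comp (ContinuousLinearMap.fst ℝ _ _) +
    (innerSL ℝ g.y).comp (ContinuousLinearMap.snd ℝ _ _)

theorem phaseForm_apply (g : Heis n) (z : Config n × Config n) :
    phaseForm g z = ⟪z.1, g.x⟫ + ⟪z.2, g.y⟫ := by
  simp [phaseForm, real_inner_comm]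

theorem norm_phaseForm_le (g : Heis n) : ‖phaseForm g‖ ≤ ‖g.x‖ + ‖g.y‖ := by
  refine ContinuousLinearMap.opNorm_le_bound _ (by positivity) fun z => ?_
  rw [phaseForm_apply, add_mul]
  refine (norm_add_le _ _).trans (add_le_add ?_ ?_)
  · rw [mul_comm]
    exact (norm_inner_le_norm _ _).trans (by gcongr; exact norm_fst_le z)
  · rw [mul_comm]
    exact (norm_inner_le_norm _ _).trans (by gcongr; exact norm_snd_le z)

theorem continuous_phaseForm : Continuous (phaseForm : Heis n → _) := by
  have hx := Heis.continuous_x (n := n)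
  have hy := Heis.continuous_y (n := n)
  unfold phaseForm
  exact (((innerSL ℝ).continuous.comp hx).clm_comp continuous_const).add
    (((innerSL ℝ).continuous.comp hy).clm_comp continuous_const)

/-- The character `g ↦ e^{i(μ t + q · x + p · y)}` of the additive group `ℝ²ⁿ⁺¹`. -/
def character (μ : ℝ) (z : Config n × Config n) (g : Heis n) : ℂ :=
  exp (I * (μ * g.t + phaseForm g z : ℝ))

theorem norm_character (μ : ℝ) (z : Config n × Config n) (g : Heis n) :
    ‖character μ z g‖ = 1 := by
  rw [character, mul_comm, norm_exp_ofReal_mul_I]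

theorem continuous_character (μ : ℝ) (z : Config n × Config n) :
    Continuous (character (n := n) μ z) := by
  have h1 := Heis.continuous_t (n := n)
  have h2 : Continuous fun g : Heis n => phaseForm g z :=
    continuous_phaseForm.clm_apply continuous_const
  unfold character
  fun_prop

theorem hat_eq (f : Heis n → ℂ) (μ : ℝ) (z : Config n × Config n) :
    hat f μ z = ∫ g, f g • character μ z g ∂haar n := by
  simp only [hat, character, phaseForm_apply, smul_eq_mul, ← add_assoc, mul_comm]

theorem classicalMap_eq {f : Heis n → ℂ} (hf : Integrable f (haar n)) :
    classicalMap f = fun z => ∫ g, f g * character 0 z g ∂haar n := by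
  funext z
  rw [classicalMap_eq_hat hf, hat_eq]
  rfl

theorem hasFDerivAt_character (z : Config n × Config n) (g : Heis n) :
    HasFDerivAt (fun z => character 0 z g)
      ((character 0 z g * I) • ofRealCLM.comp (phaseForm g)) z := by
  have h1 : HasFDerivAt (fun z => I * (0 * g.t + phaseForm g z : ℝ))
      (I • ofRealCLM.comp (phaseForm g)) z := by
    have h2 := (ofRealCLM.comp (phaseForm g)).hasFDerivAt (x := z) |>.const_mul I
    simpa using h2
  have h3 := h1.cexp
  rw [smul_smul] at h3
  exact h3

theorem norm_smul_phaseForm_le (c : ℂ) (z : Config n × Config n) (g : Heis n) :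
    ‖c • ((character 0 z g * I) • ofRealCLM.comp (phaseForm g))‖ ≤ (‖g.x‖ + ‖g.y‖) * ‖c‖ := by
  rw [norm_smul, norm_smul, norm_mul, norm_character, norm_I, one_mul, one_mul, mul_comm]
  gcongr
  refine (ContinuousLinearMap.opNorm_comp_le _ _).trans ?_
  rw [ofRealCLM_norm, one_mul]
  exact norm_phaseForm_le g

theorem HasFirstMoments.integrable_fderiv {f : Heis n → ℂ} (hm : HasFirstMoments f)
    (hf : Integrable f (haar n)) (z : Config n × Config n) :
    Integrable (fun g => f g • ((character 0 z g * I) • ofRealCLM.comp (phaseForm g)))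
      (haar n) := by
  have hc : Continuous fun g : Heis n => (character 0 z g * I) • ofRealCLM.comp (phaseForm g) :=
    ((continuous_character 0 z).mul continuous_const).smul
      (continuous_const.clm_comp continuous_phaseForm)
  refine Integrable.mono' hm (hf.aestronglyMeasurable.smul hc.aestronglyMeasurable)
    (Eventually.of_forall fun g => norm_smul_phaseForm_le _ z g)

/-- Differentiation under the integral: the first-moment integrand dominates the derivative
uniformly in `z`. -/
theorem HasFirstMoments.hasFDerivAt {f : Heis n → ℂ} (hm : HasFirstMoments f)
    (hf : Integrable f (haar n)) (z : Config n × Config n) :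
    HasFDerivAt (classicalMap f)
      (∫ g, f g • ((character 0 z g * I) • ofRealCLM.comp (phaseForm g)) ∂haar n) z := by
  have hi : ∀ z, Integrable (fun g => f g * character 0 z g) (haar n) := fun z =>
    Integrable.smul_of_norm_le hf (continuous_character 0 z).aestronglyMeasurable
      (fun g => (norm_character 0 z g).le)
  rw [classicalMap_eq hf]
  refine hasFDerivAt_integral_of_dominated_of_fderiv_le (s := Set.univ)
    (F' := fun z g => f g • ((character 0 z g * I) • ofRealCLM.comp (phaseForm g)))
    (bound := fun g => (‖g.x‖ + ‖g.y‖) * ‖f g‖) univ_mem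
    (Eventually.of_forall fun z => (hi z).aestronglyMeasurable) (hi z)
    (hm.integrable_fderiv hf z).aestronglyMeasurable
    (Eventually.of_forall fun g z _ => norm_smul_phaseForm_le _ z g) hm ?_
  exact Eventually.of_forall fun g z _ => (hasFDerivAt_character z g).const_mul (f g)

theorem HasFirstMoments.integrable_fderiv_apply {f : Heis n → ℂ} (hm : HasFirstMoments f)
    (hf : Integrable f (haar n)) (z w : Config n × Config n) :
    Integrable (fun g => f g * character 0 z g * I * phaseForm g w) (haar n) := by
  have := (ContinuousLinearMap.apply ℝ ℂ w).integrable_comp (hm.integrable_fderiv hf z)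
  simpa [mul_assoc] using this

theorem HasFirstMoments.fderiv_apply {f : Heis n → ℂ} (hm : HasFirstMoments f)
    (hf : Integrable f (haar n)) (z w : Config n × Config n) :
    fderiv ℝ (classicalMap f) z w = ∫ g, f g * character 0 z g * I * phaseForm g w ∂haar n := by
  rw [(hm.hasFDerivAt hf z).fderiv,
    ContinuousLinearMap.integral_apply (hm.integrable_fderiv hf z)]
  simp [mul_assoc]

/-- The symplectic form `y · x' - x · y'`. -/
def symplectic (a b : Heis n) : ℝ := ⟪a.y, b.x⟫ - ⟪a.x, b.y⟫

/-- On basis vectors `phaseForm` reads off the coordinates `xᵢ` and `yᵢ`. This form matches the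
factors produced by the partial derivatives of `classicalMap`. -/
theorem symplectic_eq_sum (a b : Heis n) : symplectic a b =
    ∑ i, (phaseForm a (0, EuclideanSpace.single i 1) * phaseForm b (EuclideanSpace.single i 1, 0) -
      phaseForm a (EuclideanSpace.single i 1, 0) * phaseForm b (0, EuclideanSpace.single i 1)) := by
  simp [symplectic, phaseForm_apply, PiLp.inner_apply, mul_comm]

theorem abs_symplectic_le (a b : Heis n) :
    |symplectic a b| ≤ (‖a.x‖ + ‖a.y‖) * (‖b.x‖ + ‖b.y‖) := by
  have h1 := abs_real_inner_le_norm a.y b.x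
  have h2 := abs_real_inner_le_norm a.x b.y
  have h3 := abs_sub ⟪a.y, b.x⟫ ⟪a.x, b.y⟫
  have : 0 ≤ ‖a.x‖ * ‖b.x‖ := by positivity
  have : 0 ≤ ‖a.y‖ * ‖b.y‖ := by positivity
  rw [symplectic]
  linarith

theorem character_mul (μ : ℝ) (z : Config n × Config n) (a b : Heis n) :
    character μ z (a * b) =
      exp (I * (μ * (a.t + b.t + symplectic a b / 2) + (phaseForm a z + phaseForm b z) : ℝ)) := by
  rw [character]
  congr 3
  simp only [phaseForm_apply, symplectic, Heis.mul_t, Heis.mul_x, Heis.mul_y, inner_add_right]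
  ring

theorem symplectic_swap (a b : Heis n) : symplectic b a = -symplectic a b := by
  simp only [symplectic, real_inner_comm a.x, real_inner_comm a.y]
  ring

/-- The oscillating factor in the Fourier transform of a commutator. -/
def commFactor (z : Config n × Config n) (a b : Heis n) (μ : ℝ) : ℂ :=
  character μ z (a * b) - character μ z (b * a)

/-- `a * b` and `b * a` differ by the central element `symplectic a b`, so a unimodular factor
splits off `e^{iμω} - 1`, and `|e^{iθ} - 1| ≤ |θ|`. -/
theorem norm_commFactor_le (z : Config n × Config n) (a b : Heis n) (μ : ℝ) :
    ‖commFactor z a b μ‖ ≤ |μ| * |symplectic a b| := by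
  have h1 : commFactor z a b μ = character μ z (b * a) *
      (exp (I * (μ * symplectic a b : ℝ)) - 1) := by
    rw [commFactor, mul_sub, mul_one, character_mul, character_mul, ← exp_add, symplectic_swap a b]
    congr 2
    push_cast
    ring
  rw [h1, norm_mul, norm_character, one_mul, ← abs_mul]
  exact Real.norm_exp_I_mul_ofReal_sub_one_le

/-- `commFactor` vanishes at `μ = 0`, so this is its difference quotient there; the two exponentials
share their value at `0`, and their frequencies in `μ` differ by `symplectic a b`. -/
theorem tendsto_commFactor (z : Config n × Config n) (a b : Heis n) :
    Tendsto (fun μ : ℝ => (μ : ℂ)⁻¹ * commFactor z a b μ) (𝓝[≠] 0)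
      (𝓝 (I * symplectic a b * (character 0 z a * character 0 z b))) := by
  have h1 : ∀ A B : ℝ, HasDerivAt (fun μ : ℝ => exp (I * (μ * A + B : ℝ)))
      (exp (I * B) * (I * A)) 0 := fun A B => by
    have h2 : HasDerivAt (fun μ : ℝ => μ * A + B) A 0 := by
      simpa using ((hasDerivAt_id (0 : ℝ)).mul_const A).add_const B
    simpa using (h2.ofReal_comp.const_mul I).cexp
  have h3 : HasDerivAt (commFactor z a b)
      (I * symplectic a b * (character 0 z a * character 0 z b)) 0 := by
    have h4 := (h1 (a.t + b.t + symplectic a b / 2) (phaseForm a z + phaseForm b z)).sub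
      (h1 (b.t + a.t + symplectic b a / 2) (phaseForm b z + phaseForm a z))
    have h5 : commFactor z a b =
        (fun μ : ℝ => exp (I * (μ * (a.t + b.t + symplectic a b / 2) +
          (phaseForm a z + phaseForm b z) : ℝ))) -
        fun μ : ℝ => exp (I * (μ * (b.t + a.t + symplectic b a / 2) +
          (phaseForm b z + phaseForm a z) : ℝ)) := by
      funext μ
      simp only [commFactor, character_mul, Pi.sub_apply]
    rw [h5]
    refine h4.congr_deriv ?_
    rw [symplectic_swap a b, add_comm (phaseForm b z), character, character, ← exp_add]
    simp only [zero_mul, zero_add]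
    push_cast
    ring_nf
  have h6 := h3.tendsto_slope
  refine h6.congr fun μ => ?_
  have h7 : commFactor z a b 0 = 0 := by
    simp [commFactor, character_mul, add_comm]
  rw [slope_def_module, h7, sub_zero, sub_zero, real_smul, ofReal_inv]

theorem hat_tildeH {j k : Heis n → ℂ} (hj : Integrable j (haar n)) (hk : Integrable k (haar n))
    (μ : ℝ) (z : Config n × Config n) :
    hat (tildeH j k) μ z =
      ∫ p : Heis n × Heis n, j p.1 * k p.2 * commFactor z p.1 p.2 μ ∂(haar n).prod (haar n) := by
  have hb : ∀ g, ‖character μ z g‖ ≤ 1 := fun g => (norm_character μ z g).le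
  have hc := continuous_character (n := n) μ z
  have hi : ∀ {f : Heis n → ℂ}, Integrable f (haar n) →
      Integrable (fun g => f g • character μ z g) (haar n) := fun hf =>
    Integrable.smul_of_norm_le hf hc.aestronglyMeasurable hb
  have hswap : ∫ p : Heis n × Heis n, (k p.1 * j p.2) • character μ z (p.1 * p.2)
        ∂(haar n).prod (haar n) =
      ∫ p : Heis n × Heis n, (j p.1 * k p.2) • character μ z (p.2 * p.1)
        ∂(haar n).prod (haar n) := by
    rw [← integral_prod_swap]
    simp only [Prod.fst_swap, Prod.snd_swap, mul_comm (k _)]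
  rw [hat_eq, tildeH_eq]
  simp only [sub_smul]
  rw [integral_sub (hi (integrable_conv hj hk)) (hi (integrable_conv hk hj)),
    integral_conv_smul hj hk hc hb, integral_conv_smul hk hj hc hb, hswap, ← integral_sub]
  · simp only [smul_eq_mul, commFactor, mul_sub]
  · exact Integrable.smul_of_norm_le (hj.mul_prod hk)
      (hc.comp Heis.continuous_mul).aestronglyMeasurable fun p => hb _
  · exact Integrable.smul_of_norm_le (hj.mul_prod hk)
      (hc.comp (Heis.continuous_mul.comp continuous_swap)).aestronglyMeasurable fun p => hb _

/-- Each partial derivative brings down `i` times a coordinate. A product of two integrals is one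
integral over the product space, and `i² = -1` produces the sign. -/
theorem integral_symplectic {j k : Heis n → ℂ} (hj : Integrable j (haar n))
    (hk : Integrable k (haar n)) (hj' : HasFirstMoments j) (hk' : HasFirstMoments k)
    (z : Config n × Config n) :
    ∫ p : Heis n × Heis n, j p.1 * k p.2 *
        (I * symplectic p.1 p.2 * (character 0 z p.1 * character 0 z p.2))
        ∂(haar n).prod (haar n) =
      -(I * poisson (classicalMap k) (classicalMap j) z) := by
  have hi := fun v w => (hj'.integrable_fderiv_apply hj z v).mul_prod
    (hk'.integrable_fderiv_apply hk z w)
  have hs : ∀ v w v' w', Integrable (fun p : Heis n × Heis n =>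
      j p.1 * character 0 z p.1 * I * phaseForm p.1 v *
          (k p.2 * character 0 z p.2 * I * phaseForm p.2 w) -
        j p.1 * character 0 z p.1 * I * phaseForm p.1 v' *
          (k p.2 * character 0 z p.2 * I * phaseForm p.2 w')) ((haar n).prod (haar n)) :=
    fun v w v' w' => (hi v w).sub (hi v' w')
  simp only [poisson, hj'.fderiv_apply hj, hk'.fderiv_apply hk]
  -- The factor from `j` is put first, so that all products become integrals in the same order of
  -- variables.
  simp only [mul_comm (∫ g, k g * _ * _ * _ ∂haar n), ← integral_prod_mul]
  simp only [← integral_sub (hi _ _) (hi _ _)]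
  rw [← integral_finsetSum _ fun i _ => hs _ _ _ _, ← integral_const_mul,
    ← integral_neg]
  refine integral_congr_ae (Eventually.of_forall fun p => ?_)
  simp only [symplectic_eq_sum]
  push_cast
  simp only [Finset.mul_sum, Finset.sum_mul, ← Finset.sum_neg_distrib]
  refine Finset.sum_congr rfl fun i _ => ?_
  linear_combination (I * j p.1 * k p.2 * character 0 z p.1 * character 0 z p.2 *
    ((phaseForm p.1 (0, EuclideanSpace.single i 1) : ℂ) *
        phaseForm p.2 (EuclideanSpace.single i 1, 0) -
      phaseForm p.1 (EuclideanSpace.single i 1, 0) *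
        phaseForm p.2 (0, EuclideanSpace.single i 1))) * I_mul_I

/-- The classical image of the commutator of two convolutions. -/
theorem hasClassicalImage_neg_tildeH {j k : Heis n → ℂ} (hj : Integrable j (haar n))
    (hk : Integrable k (haar n)) (hj' : HasFirstMoments j) (hk' : HasFirstMoments k) :
    HasClassicalImage (fun h => -tildeH j k h)
      (fun z => I * poisson (classicalMap k) (classicalMap j) z) := by
  intro z
  have hneg : ∀ μ, hat (fun h => -tildeH j k h) μ z = -hat (tildeH j k) μ z := fun μ => by
    simp only [hat, mul_neg, integral_neg]
  have hlim : Tendsto (fun μ : ℝ => ∫ p : Heis n × Heis n,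
      j p.1 * k p.2 * ((μ : ℂ)⁻¹ * commFactor z p.1 p.2 μ) ∂(haar n).prod (haar n)) (𝓝[≠] 0)
      (𝓝 (-(I * poisson (classicalMap k) (classicalMap j) z))) := by
    rw [← integral_symplectic hj hk hj' hk' z]
    -- The majorant is the product of the two first-moment integrands: the symplectic form is
    -- bounded by a product of norms, and the factor `|μ|` in `norm_commFactor_le` cancels `μ⁻¹`.
    refine tendsto_integral_filter_of_dominated_convergence
      (fun p : Heis n × Heis n =>
        ((‖p.1.x‖ + ‖p.1.y‖) * ‖j p.1‖) * ((‖p.2.x‖ + ‖p.2.y‖) * ‖k p.2‖))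
      (Eventually.of_forall fun μ => ?_) ?_ (Integrable.mul_prod hj' hk') ?_
    · have hc := continuous_character (n := n) μ z
      have h1 : Continuous fun p : Heis n × Heis n => commFactor z p.1 p.2 μ :=
        (hc.comp Heis.continuous_mul).sub (hc.comp (Heis.continuous_mul.comp continuous_swap))
      exact (hj.mul_prod hk).aestronglyMeasurable.mul
        (continuous_const.mul h1).aestronglyMeasurable
    · filter_upwards [self_mem_nhdsWithin] with μ hμ
      refine Eventually.of_forall fun p => ?_
      have h1 : ‖(μ : ℂ)⁻¹ * commFactor z p.1 p.2 μ‖ ≤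
          (‖p.1.x‖ + ‖p.1.y‖) * (‖p.2.x‖ + ‖p.2.y‖) := by
        rw [norm_mul, norm_inv, norm_real, Real.norm_eq_abs, inv_mul_le_iff₀ (abs_pos.2 hμ)]
        exact (norm_commFactor_le z p.1 p.2 μ).trans
          (mul_le_mul_of_nonneg_left (abs_symplectic_le _ _) (abs_nonneg _))
      rw [norm_mul, norm_mul]
      calc _ ≤ ‖j p.1‖ * ‖k p.2‖ * ((‖p.1.x‖ + ‖p.1.y‖) * (‖p.2.x‖ + ‖p.2.y‖)) := by gcongr
        _ = _ := by ring
    · exact Eventually.of_forall fun p => (tendsto_commFactor z p.1 p.2).const_mul _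
  have h2 := hlim.neg
  rw [neg_neg] at h2
  refine h2.congr fun μ => ?_
  rw [hneg, hat_tildeH hj hk, mul_neg, ← integral_const_mul]
  congr 2
  funext p
  ring

theorem hasDerivAt_classicalMap {k : ℝ → Kernels n} {s : ℝ} (hk : DifferentiableAt ℝ k s)
    (z : Config n × Config n) :
    HasDerivAt (fun r => classicalMap (k r) z) (classicalMap (deriv k s : Kernels n) z) s :=
  ((ContinuousLinearMap.apply ℂ ℂ (1 : ℂ)).restrictScalars ℝ).hasFDerivAt.comp_hasDerivAt s
    ((classicalRep z.1 z.2).hasDerivAt_integrated hk)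

theorem continuous_hat {f : Heis n → ℂ} (hf : Integrable f (haar n)) (z : Config n × Config n) :
    Continuous fun μ => hat f μ z := by
  simp only [hat_eq]
  refine continuous_of_dominated (bound := fun g => ‖f g‖) (fun μ => ?_) (fun μ => ?_) hf.norm ?_
  · exact hf.aestronglyMeasurable.smul (continuous_character μ z).aestronglyMeasurable
  · exact Eventually.of_forall fun g => by rw [norm_smul, norm_character, mul_one]
  · refine Eventually.of_forall fun g => ?_
    unfold character
    fun_prop

/-- `hat ℓ μ` is exactly `iμ` times the transform of `∂k/∂s`, which is continuous in `μ` and equals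
the classical map at `0`. No moments are needed. -/
theorem IsTauCentralDeriv.hasClassicalImage {k : ℝ → Kernels n} {s : ℝ} {ℓ : Heis n → ℂ}
    (h : IsTauCentralDeriv k s ℓ) :
    HasClassicalImage ℓ (fun z => I * deriv (fun r => classicalMap (k r) z) s) := by
  intro z
  have hk := Kernels.integrable (deriv k s)
  have h1 : ∀ μ, hat ℓ μ z = (I * μ) * hat (deriv k s : Kernels n) μ z := fun μ => by
    rw [hat_eq, hat_eq, ← smul_eq_mul (I * (μ : ℂ))]
    refine h.integral_smul μ (continuous_character μ z) (fun g => (norm_character μ z g).le)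
      fun g => ?_
    rw [character, character, smul_eq_mul, ← exp_add]
    congr 1
    simp only [phaseForm_apply, Heis.t_mk, Heis.x_mk, Heis.y_mk]
    push_cast
    ring
  simp only [(hasDerivAt_classicalMap h.1 z).deriv, classicalMap_eq_hat hk]
  have h2 : Tendsto (fun μ => I * hat (deriv k s : Kernels n) μ z) (𝓝[≠] 0)
      (𝓝 (I * hat (deriv k s : Kernels n) 0 z)) :=
    (((continuous_hat hk z).tendsto 0).mono_left nhdsWithin_le_nhds).const_mul I
  refine h2.congr' ?_
  filter_upwards [self_mem_nhdsWithin] with μ hμ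
  have hμ' : (μ : ℂ) ≠ 0 := ofReal_ne_zero.2 hμ
  rw [h1]
  field_simp

end ClassicalLimit

end PlainMechanics

end

/-! ### Assembly: the commutator, the Heisenberg equation and the Hamilton equation. -/

theorem mainTheorem2 (n : ℕ) (j : Kernels n) (k : ℝ → Kernels n)
    (s : ℝ) :
    -- the operator of two-sided convolution yields the commutator of convolutions
    (Integrable (tildeH j (k s)) (haar n) ∧
      opComm (leftConv j) (leftConv (k s)) =
        leftConv (tildeH j (k s))) ∧
    -- a quantum representation turns the main equation into the Heisenberg equation
    (∀ μ : ℝ, μ ≠ 0 →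
      (∀ ℓ : Heis n → ℂ, IsTauCentralDeriv k s ℓ →
        DifferentiableAt ℝ (fun r => quantumImage μ (k r)) s ∧
        quantumImage μ ℓ =
          (Complex.I * μ) • deriv (fun r => quantumImage μ (k r)) s) ∧
      quantumImage μ (fun h => -tildeH j (k s) h) =
        -opComm (quantumImage μ j) (quantumImage μ (k s)) ∧
      (MainEquationAt j k s →
        HasDerivAt (fun r => quantumImage μ (k r))
          ((Complex.I / μ) • opComm (quantumImage μ j)
            (quantumImage μ (k s))) s)) ∧
    -- the classical map turns the main equation into the Hamilton equation
    (HasFirstMoments j → HasFirstMoments (k s) →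
      Differentiable ℝ (classicalMap (n := n) j) ∧
      Differentiable ℝ (classicalMap (n := n) (k s)) ∧
      (∀ ℓ : Heis n → ℂ, IsTauCentralDeriv k s ℓ →
        (∀ z, DifferentiableAt ℝ (fun r => classicalMap (k r) z) s) ∧
        HasClassicalImage ℓ
          (fun z => Complex.I * deriv (fun r => classicalMap (k r) z) s)) ∧
      HasClassicalImage (fun h => -tildeH j (k s) h)
        (fun z => Complex.I *
          poisson (classicalMap (k s)) (classicalMap j) z) ∧
      (MainEquationAt j k s → ∀ z,
        HasDerivAt (fun r => classicalMap (k r) z)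
          (poisson (classicalMap (k s))
            (classicalMap j) z) s)) := by
  have hj := j.integrable
  have hk := (k s).integrable
  have hH := integrable_tildeH hj hk
  refine ⟨⟨hH, ((leftRegular n).integrated_tildeH hj hk).symm⟩, fun μ hμ => ?_, fun hj' hk' => ?_⟩
  · have hcomm : quantumImage μ (fun h => -tildeH j (k s) h) =
        -opComm (quantumImage μ j) (quantumImage μ (k s)) := by
      rw [quantumImage, UnitaryRep.integrated_neg _ hH, UnitaryRep.integrated_tildeH _ hj hk]
      rfl
    have hdiff : DifferentiableAt ℝ k s → DifferentiableAt ℝ (fun r => quantumImage μ (k r)) s :=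
      fun h => ((quantumRep n μ).hasDerivAt_integrated h).differentiableAt
    refine ⟨fun ℓ hℓ => ⟨hdiff hℓ.1, hℓ.quantumImage_eq μ⟩, hcomm, fun h => ?_⟩
    have h1 := h.quantumImage_eq μ
    rw [hcomm] at h1
    -- The two images of the main equation read `-[·,·] = iμ · d/ds`; multiply by `-i/μ`, using
    -- `-(i/μ)(iμ) = 1`.
    have h2 : (Complex.I / μ) • opComm (quantumImage μ j) (quantumImage μ (k s)) =
        deriv (fun r => quantumImage μ (k r)) s := by
      rw [← neg_neg (opComm _ _), h1, ← smul_neg, smul_smul, ← neg_smul_neg, neg_neg]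
      have h3 : -(Complex.I / μ * (Complex.I * μ)) = 1 := by
        have : (μ : ℂ) ≠ 0 := Complex.ofReal_ne_zero.2 hμ
        field_simp
        rw [Complex.I_sq, neg_neg]
      rw [h3, one_smul]
    rw [h2]
    exact (hdiff h.1).hasDerivAt
  · have himage := hasClassicalImage_neg_tildeH hj hk hj' hk'
    refine ⟨fun z => (hj'.hasFDerivAt hj z).differentiableAt,
      fun z => (hk'.hasFDerivAt hk z).differentiableAt, fun ℓ hℓ =>
      ⟨fun z => (hasDerivAt_classicalMap hℓ.1 z).differentiableAt, hℓ.hasClassicalImage⟩, himage,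
      fun h z => ?_⟩
    -- Under the main equation both classical images are limits of the same function of `μ`, so they
    -- agree; the common factor `i` is cancelled.
    rw [← mul_left_cancel₀ Complex.I_ne_zero
      (tendsto_nhds_unique (h.hasClassicalImage z) (himage z))]
    exact (hasDerivAt_classicalMap h.1 z).differentiableAt.hasDerivAt
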